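/- **Definitions.** A *horizontal almost $\iota_K$-complex* is a pair $(C,\iota)$, where $C$ is a bigraded chain complex of finitely generated free $\mathbb{F}_2[U]$-modules with bigrading $(A,M)\in\mathbb{Z}^2$, $U$ has bidegree $(-1,-2)$, the differential $\partial$ has bidegree $(0,-1)$, and $\iota\colon\widehat C\to\widehat C$ is a chain homotopy equivalence of $\widehat C=C/UC$, such that: * $U^{-1}C$ is homotopy equivalent, as a bigraded complex, to $\mathbb{F}_2[U,U^{-1}]$ with $1$ in bidegree $(0,0)$; * $\iota$ is skew-graded, i.e. it sends bidegree $(A,M)$ to bidegree $(-A,M-2A)$; * $\Phi\iota\Phi\iota\sim\iota\Phi\iota\Phi$ and $\iota^2\sim 1+\Phi\iota\Phi\iota$ on $\widehat C$; * there is a chain map $C\to C$ of bidegree $(-1,-1)$ whose reduction modulo $U$ is homotopic to $\iota\Phi\iota$. Here $\Phi$ is the formal derivative of $\partial$ with respect to $U$ (in a homogeneous basis), and $\sim$ is chain homotopy. An *almost $\iota_K$-local map* $(C,\iota_C)\to(D,\iota_D)$ is a degree-preserving $\mathbb{F}_2[U]$-linear chain map $f\colon C\to D$ such that $U^{-1}f$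 is a homotopy equivalence and $\iota_D\widehat f\sim\widehat f\,\iota_C$. Write $C\le D$ if such a map exists; $C$ and $D$ are *almost $\iota_K$-locally equivalent* if $C\le D$ and $D\le C$. Let $\mathfrak{I}^U_K$ be the set of equivalence classes, partially ordered by $\le$. It is an abelian group under $$[C]+[D]=\bigl[\,C\otimes_{\mathbb{F}_2[U]}D,\ \iota_C\otimes\iota_D+\Phi\iota_C\otimes\iota_D\Phi\,\bigr],$$ with zero element the class of $\mathbb{F}_2[U]$ (with $1$ in bidegree $(0,0)$ and the trivial involution) and with inverses given by dual complexes. Two elements are *incomparable* if neither is $\le$ the other. The figure-eight complex $C_E$ is freely generated by $a,b,c,d,x$ of bidegrees $(0,0),(1,1),(-1,-1),(0,0),(0,0)$, with $$\partial a=Ub,\quad \partial c=Ud,\quad \partial b=\partial d=\partial x=0,$$ $$\iota(a)=a+x,\quad \iota(b)=c,\quad \iota(c)=b,\quad \iota(d)=d,\quad \iota(x)=x+d.$$ **Theorem.** Two elements $[C],[D]\in\mathfrak{I}^U_K$ are incomparable if and only if $[C]=[D]+[C_E]$. Moreover $[C_E]$ has order $2$ in $\mathfrak{I}^U_K$, and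 on the quotient group $\mathfrak{I}^U_K/\langle[C_E]\rangle$ the induced relation ($p\le q$ if some representatives $x$ of $p$ and $y$ of $q$ satisfy $x\le y$) is a translation-invariant total order. -/

import Mathlib

namespace HorizontalIota

open Polynomial LaurentPolynomial Matrix
open scoped Kronecker

noncomputable section

set_option linter.unusedSimpArgs false
set_option linter.unusedSectionVars false

theorem add_self_zero {R I J : Type*} [CommRing R] [CharP R 2] (M : Matrix I J R) : M + M = 0 := by
  ext i j; simp [CharTwo.add_self_eq_zero]

theorem eq_of_add_zero {R I J : Type*} [CommRing R] [CharP R 2] {M N : Matrix I J R}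
    (h : M + N = 0) : M = N := by
  rw [← add_zero M, ← add_self_zero N, ← add_assoc, h, zero_add]

section Homotopy

variable {R : Type*} [CommRing R]
variable {I J K I' J' K' : Type*} [Fintype I] [Fintype J] [Fintype K] [Fintype I'] [Fintype J']
  [Fintype K']

/-- A chain map between the based complexes `(R^I, dC)` and `(R^J, dD)`. Matrices act on column
vectors: the entry `f j i` is the coefficient of the basis vector `j` in the image of `i`. -/
def IsChainMap (dC : Matrix I I R) (dD : Matrix J J R) (f : Matrix J I R) : Prop :=
  dD * f = f * dC

/-- Chain homotopy of maps `(R^I, dC) → (R^J, dD)` (the rings below have characteristic two, so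
there are no signs). The homotopy is any `R`-linear map: when the data are bigraded, a homotopy
between two homogeneous maps can be replaced by its homogeneous part of the right bidegree. -/
def Homotopic (dC : Matrix I I R) (dD : Matrix J J R) (f g : Matrix J I R) : Prop :=
  ∃ h : Matrix J I R, f = g + (dD * h + h * dC)

/-- `f` and `g` are chain maps which are homotopy inverses of each other. -/
structure IsHomotopyInverse [DecidableEq I] [DecidableEq J] (dC : Matrix I I R)
    (dD : Matrix J J R) (f : Matrix J I R) (g : Matrix I J R) : Prop where
  chain_f : IsChainMap dC dD f
  chain_g : IsChainMap dD dC g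
  left : Homotopic dC dC (g * f) 1
  right : Homotopic dD dD (f * g) 1

/-- `f` is a chain homotopy equivalence. -/
def IsHomotopyEquiv [DecidableEq I] [DecidableEq J] (dC : Matrix I I R) (dD : Matrix J J R)
    (f : Matrix J I R) : Prop :=
  ∃ g : Matrix I J R, IsHomotopyInverse dC dD f g

/-- The differential `∂ ⊗ 1 + 1 ⊗ ∂` of the tensor product of two based complexes. -/
def tensorD [DecidableEq I] [DecidableEq J] (dC : Matrix I I R) (dD : Matrix J J R) :
    Matrix (I × J) (I × J) R :=
  dC ⊗ₖ (1 : Matrix J J R) + (1 : Matrix I I R) ⊗ₖ dD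

theorem IsChainMap.mul {dC : Matrix I I R} {dD : Matrix J J R} {dE : Matrix K K R}
    {f : Matrix J I R} {g : Matrix K J R} (hg : IsChainMap dD dE g) (hf : IsChainMap dC dD f) :
    IsChainMap dC dE (g * f) := by
  unfold IsChainMap at *
  rw [← Matrix.mul_assoc, hg, Matrix.mul_assoc, hf, Matrix.mul_assoc]

theorem IsChainMap.add {dC : Matrix I I R} {dD : Matrix J J R}
    {f g : Matrix J I R} (hf : IsChainMap dC dD f) (hg : IsChainMap dC dD g) :
    IsChainMap dC dD (f + g) := by
  unfold IsChainMap at *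
  rw [Matrix.mul_add, Matrix.add_mul, hf, hg]

theorem IsChainMap.one [DecidableEq I] (dC : Matrix I I R) : IsChainMap dC dC 1 := by
  simp [IsChainMap]

theorem Homotopic.refl {dC : Matrix I I R} {dD : Matrix J J R} (f : Matrix J I R) :
    Homotopic dC dD f f := ⟨0, by simp⟩

theorem Homotopic.of_eq {dC : Matrix I I R} {dD : Matrix J J R} {f g : Matrix J I R}
    (h : f = g) : Homotopic dC dD f g := h ▸ Homotopic.refl f

theorem Homotopic.symm {dC : Matrix I I R} {dD : Matrix J J R} {f g : Matrix J I R}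
    (h : Homotopic dC dD f g) : Homotopic dC dD g f := by
  obtain ⟨h, rfl⟩ := h
  exact ⟨-h, by simp only [Matrix.mul_neg, Matrix.neg_mul]; abel⟩

theorem Homotopic.trans {dC : Matrix I I R} {dD : Matrix J J R} {f g k : Matrix J I R}
    (h : Homotopic dC dD f g) (h' : Homotopic dC dD g k) : Homotopic dC dD f k := by
  obtain ⟨h, rfl⟩ := h
  obtain ⟨h', rfl⟩ := h'
  exact ⟨h + h', by simp only [Matrix.mul_add, Matrix.add_mul]; abel⟩

theorem Homotopic.add {dC : Matrix I I R} {dD : Matrix J J R} {f g f' g' : Matrix J I R}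
    (h : Homotopic dC dD f g) (h' : Homotopic dC dD f' g') :
    Homotopic dC dD (f + f') (g + g') := by
  obtain ⟨h, rfl⟩ := h
  obtain ⟨h', rfl⟩ := h'
  exact ⟨h + h', by simp only [Matrix.mul_add, Matrix.add_mul]; abel⟩

theorem Homotopic.mul_left {dC : Matrix I I R} {dD : Matrix J J R} {dE : Matrix K K R}
    {f f' : Matrix J I R} {g : Matrix K J R} (hg : IsChainMap dD dE g)
    (h : Homotopic dC dD f f') : Homotopic dC dE (g * f) (g * f') := by
  obtain ⟨h, rfl⟩ := h
  refine ⟨g * h, ?_⟩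
  rw [← Matrix.mul_assoc dE, hg]
  simp only [Matrix.mul_add, Matrix.mul_assoc]

theorem Homotopic.mul_right {dC : Matrix I I R} {dD : Matrix J J R} {dE : Matrix K K R}
    {f : Matrix J I R} {g g' : Matrix K J R} (hf : IsChainMap dC dD f)
    (h : Homotopic dD dE g g') : Homotopic dC dE (g * f) (g' * f) := by
  obtain ⟨h, rfl⟩ := h
  refine ⟨h * f, ?_⟩
  rw [Matrix.mul_assoc h, ← hf]
  simp only [Matrix.add_mul, Matrix.mul_assoc]

theorem IsChainMap.map {S : Type*} [CommRing S] (φ : R →+* S) {dC : Matrix I I R}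
    {dD : Matrix J J R} {f : Matrix J I R} (hf : IsChainMap dC dD f) :
    IsChainMap (dC.map φ) (dD.map φ) (f.map φ) := by
  unfold IsChainMap at *
  rw [← Matrix.map_mul, ← Matrix.map_mul, hf]

theorem Homotopic.map {S : Type*} [CommRing S] (φ : R →+* S) {dC : Matrix I I R}
    {dD : Matrix J J R} {f g : Matrix J I R} (hf : Homotopic dC dD f g) :
    Homotopic (dC.map φ) (dD.map φ) (f.map φ) (g.map φ) := by
  obtain ⟨h, rfl⟩ := hf
  refine ⟨h.map φ, ?_⟩
  rw [← Matrix.map_mul, ← Matrix.map_mul, ← Matrix.map_add φ (map_add φ),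
    ← Matrix.map_add φ (map_add φ)]

section Equiv

variable [DecidableEq I] [DecidableEq J] [DecidableEq K]

theorem IsHomotopyInverse.symm {dC : Matrix I I R} {dD : Matrix J J R} {f : Matrix J I R}
    {g : Matrix I J R} (h : IsHomotopyInverse dC dD f g) : IsHomotopyInverse dD dC g f :=
  ⟨h.chain_g, h.chain_f, h.right, h.left⟩

theorem IsHomotopyInverse.comp {dC : Matrix I I R} {dD : Matrix J J R} {dE : Matrix K K R}
    {f : Matrix J I R} {g : Matrix I J R} {f' : Matrix K J R} {g' : Matrix J K R}
    (h : IsHomotopyInverse dC dD f g) (h' : IsHomotopyInverse dD dE f' g') :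
    IsHomotopyInverse dC dE (f' * f) (g * g') where
  chain_f := h'.chain_f.mul h.chain_f
  chain_g := h.chain_g.mul h'.chain_g
  left := by
    have := Homotopic.mul_left h.chain_g (Homotopic.mul_right h.chain_f h'.left)
    rw [Matrix.one_mul] at this
    refine Homotopic.trans ?_ h.left
    simpa only [Matrix.mul_assoc] using this
  right := by
    have := Homotopic.mul_left h'.chain_f (Homotopic.mul_right h'.chain_g h.right)
    rw [Matrix.one_mul] at this
    refine Homotopic.trans ?_ h'.right
    simpa only [Matrix.mul_assoc] using this

theorem IsHomotopyEquiv.comp {dC : Matrix I I R} {dD : Matrix J J R} {dE : Matrix K K R}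
    {f : Matrix J I R} {f' : Matrix K J R}
    (h' : IsHomotopyEquiv dD dE f') (h : IsHomotopyEquiv dC dD f) :
    IsHomotopyEquiv dC dE (f' * f) :=
  ⟨_, h.choose_spec.comp h'.choose_spec⟩

/-- If `e` and `f ∘ e` are homotopy equivalences, so is the chain map `f`. -/
theorem IsHomotopyEquiv.of_comp_right {dC : Matrix I I R} {dD : Matrix J J R}
    {dE : Matrix K K R} {e : Matrix J I R} {f : Matrix K J R} (hf : IsChainMap dD dE f)
    (he : IsHomotopyEquiv dC dD e) (h : IsHomotopyEquiv dC dE (f * e)) :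
    IsHomotopyEquiv dD dE f := by
  obtain ⟨e', he⟩ := he
  obtain ⟨g, hg⟩ := h
  refine ⟨e * g, hf, he.chain_f.mul hg.chain_g, ?_, ?_⟩
  · have h1 : Homotopic dD dD (e * g * f * (e * e')) (e * g * f * 1) :=
      Homotopic.mul_left ((he.chain_f.mul hg.chain_g).mul hf) he.right
    have h2 : Homotopic dD dD (e * (g * (f * e)) * e') (e * (1 : Matrix I I R) * e') :=
      Homotopic.mul_right he.chain_g (Homotopic.mul_left he.chain_f hg.left)
    simp only [Matrix.mul_assoc, Matrix.mul_one] at h1 h2 ⊢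
    exact h1.symm.trans (h2.trans (by simpa using he.right))
  · simpa only [Matrix.mul_assoc] using hg.right

/-- If `e` and `e ∘ f` are homotopy equivalences, so is the chain map `f`. -/
theorem IsHomotopyEquiv.of_comp_left {dC : Matrix I I R} {dD : Matrix J J R}
    {dE : Matrix K K R} {f : Matrix J I R} {e : Matrix K J R} (hf : IsChainMap dC dD f)
    (he : IsHomotopyEquiv dD dE e) (h : IsHomotopyEquiv dC dE (e * f)) :
    IsHomotopyEquiv dC dD f := by
  obtain ⟨e', he⟩ := he
  obtain ⟨g, hg⟩ := h
  refine ⟨g * e, hf, hg.chain_g.mul he.chain_f, ?_, ?_⟩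
  · simpa only [Matrix.mul_assoc] using hg.left
  · have h1 : Homotopic dD dD (e' * e * (f * (g * e))) (1 * (f * (g * e))) :=
      Homotopic.mul_right (hf.mul (hg.chain_g.mul he.chain_f)) he.left
    have h2 : Homotopic dD dD (e' * (e * f * g * e)) (e' * ((1 : Matrix K K R) * e)) :=
      Homotopic.mul_left he.chain_g (Homotopic.mul_right he.chain_f hg.right)
    simp only [Matrix.mul_assoc, Matrix.one_mul] at h1 h2 ⊢
    exact h1.symm.trans (h2.trans (by simpa using he.left))

end Equiv

section Transpose

theorem IsChainMap.transpose {dC : Matrix I I R} {dD : Matrix J J R} {f : Matrix J I R}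
    (hf : IsChainMap dC dD f) : IsChainMap dDᵀ dCᵀ fᵀ := by
  unfold IsChainMap at *
  rw [← Matrix.transpose_mul, ← Matrix.transpose_mul, hf]

theorem Homotopic.transpose {dC : Matrix I I R} {dD : Matrix J J R} {f g : Matrix J I R}
    (hf : Homotopic dC dD f g) : Homotopic dDᵀ dCᵀ fᵀ gᵀ := by
  obtain ⟨h, rfl⟩ := hf
  refine ⟨hᵀ, ?_⟩
  simp only [Matrix.transpose_add, Matrix.transpose_mul]
  abel

theorem IsHomotopyInverse.transpose [DecidableEq I] [DecidableEq J] {dC : Matrix I I R}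
    {dD : Matrix J J R} {f : Matrix J I R} {g : Matrix I J R}
    (h : IsHomotopyInverse dC dD f g) : IsHomotopyInverse dDᵀ dCᵀ fᵀ gᵀ where
  chain_f := h.chain_f.transpose
  chain_g := h.chain_g.transpose
  left := by simpa using h.right.transpose
  right := by simpa using h.left.transpose

end Transpose

section Tensor

variable [DecidableEq I] [DecidableEq J] [DecidableEq I'] [DecidableEq J']

theorem IsChainMap.kronecker {dC : Matrix I I R} {dC' : Matrix I' I' R} {dD : Matrix J J R}
    {dD' : Matrix J' J' R} {f : Matrix I' I R} {g : Matrix J' J R} (hf : IsChainMap dC dC' f)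
    (hg : IsChainMap dD dD' g) : IsChainMap (tensorD dC dD) (tensorD dC' dD') (f ⊗ₖ g) := by
  unfold IsChainMap tensorD at *
  simp only [Matrix.add_mul, Matrix.mul_add, ← Matrix.mul_kronecker_mul, Matrix.one_mul,
    Matrix.mul_one, hf, hg]

variable [CharP R 2]

theorem Homotopic.kronecker_left {dC : Matrix I I R} {dC' : Matrix I' I' R} {dD : Matrix J J R}
    {dD' : Matrix J' J' R} {f f' : Matrix I' I R} {g : Matrix J' J R}
    (hf : Homotopic dC dC' f f') (hg : IsChainMap dD dD' g) :
    Homotopic (tensorD dC dD) (tensorD dC' dD') (f ⊗ₖ g) (f' ⊗ₖ g) := by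
  obtain ⟨h, rfl⟩ := hf
  refine ⟨h ⊗ₖ g, ?_⟩
  unfold IsChainMap tensorD at *
  simp only [Matrix.add_mul, Matrix.mul_add, ← Matrix.mul_kronecker_mul, Matrix.one_mul,
    Matrix.mul_one, hg, Matrix.add_kronecker]
  have := add_self_zero (h ⊗ₖ (g * dD))
  rw [← sub_eq_zero]
  rw [← neg_eq_zero, ← this]
  abel

theorem Homotopic.kronecker_right {dC : Matrix I I R} {dC' : Matrix I' I' R} {dD : Matrix J J R}
    {dD' : Matrix J' J' R} {f : Matrix I' I R} {g g' : Matrix J' J R}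
    (hf : IsChainMap dC dC' f) (hg : Homotopic dD dD' g g') :
    Homotopic (tensorD dC dD) (tensorD dC' dD') (f ⊗ₖ g) (f ⊗ₖ g') := by
  obtain ⟨h, rfl⟩ := hg
  refine ⟨f ⊗ₖ h, ?_⟩
  unfold IsChainMap tensorD at *
  simp only [Matrix.add_mul, Matrix.mul_add, ← Matrix.mul_kronecker_mul, Matrix.one_mul,
    Matrix.mul_one, hf, Matrix.kronecker_add]
  have := add_self_zero ((f * dC) ⊗ₖ h)
  rw [← sub_eq_zero]
  rw [← neg_eq_zero, ← this]
  abel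

theorem IsHomotopyInverse.kronecker {dC : Matrix I I R} {dC' : Matrix I' I' R}
    {dD : Matrix J J R} {dD' : Matrix J' J' R} {f : Matrix I' I R} {f' : Matrix I I' R}
    {g : Matrix J' J R} {g' : Matrix J J' R}
    (hf : IsHomotopyInverse dC dC' f f') (hg : IsHomotopyInverse dD dD' g g') :
    IsHomotopyInverse (tensorD dC dD) (tensorD dC' dD') (f ⊗ₖ g) (f' ⊗ₖ g') where
  chain_f := hf.chain_f.kronecker hg.chain_f
  chain_g := hf.chain_g.kronecker hg.chain_g
  left := by
    rw [← Matrix.mul_kronecker_mul, ← Matrix.one_kronecker_one]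
    exact (hf.left.kronecker_left (hg.chain_g.mul hg.chain_f)).trans
      (hg.left.kronecker_right (IsChainMap.one _))
  right := by
    rw [← Matrix.mul_kronecker_mul, ← Matrix.one_kronecker_one]
    exact (hf.right.kronecker_left (hg.chain_f.mul hg.chain_g)).trans
      (hg.right.kronecker_right (IsChainMap.one _))

end Tensor

section EndRing

variable [DecidableEq I]

/-- The ring of chain endomorphisms of a based complex. -/
def chainEnd (d : Matrix I I R) : Subring (Matrix I I R) := Subring.centralizer {d}

theorem mem_chainEnd {d f : Matrix I I R} : f ∈ chainEnd d ↔ IsChainMap d d f := by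
  simp [chainEnd, Subring.mem_centralizer_iff, IsChainMap]

/-- Homotopy as a congruence on the ring of chain endomorphisms. -/
def htpyCon (d : Matrix I I R) : RingCon (chainEnd d) where
  r a b := Homotopic d d a.1 b.1
  iseqv := ⟨fun _ => Homotopic.refl _, Homotopic.symm, Homotopic.trans⟩
  add' h h' := h.add h'
  mul' {_ b c _} h h' :=
    (Homotopic.mul_right (mem_chainEnd.1 c.2) h).trans (Homotopic.mul_left (mem_chainEnd.1 b.2) h')

theorem htpyCon_iff {d : Matrix I I R} (a b : chainEnd d) :
    ((a : (htpyCon d).Quotient) = b) ↔ Homotopic d d a.1 b.1 :=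
  (htpyCon d).eq

end EndRing

end Homotopy

section Words
/-! Identities in the homotopy ring of a tensor product: `p, i` and `q, j` stand for `Φ, ι` of the
two factors. -/
variable {H : Type*} [Ring H]

structure IotaRel (p i : H) : Prop where
  pp : p * p = 0
  ii : i * i = 1 + p * (i * (p * i))
  ipip : i * (p * (i * p)) = p * (i * (p * i))

theorem IotaRel.tensor (two : ∀ x : H, x + x = 0) {p i q j : H} (h : IotaRel p i)
    (h' : IotaRel q j) (pq : q * p = p * q) (pj : j * p = p * j) (iq : q * i = i * q)
    (ij : j * i = i * j) : IotaRel (p + q) (i * j + p * i * (j * q)) := by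
  have t : ∀ x y : H, x + (x + y) = y := fun x y => by rw [← add_assoc, two, zero_add]
  have pp := h.pp
  have pp' : ∀ x, p * (p * x) = 0 := fun x => by rw [← mul_assoc, pp, zero_mul]
  have ii := h.ii
  have ii' : ∀ x, i * (i * x) = x + p * (i * (p * (i * x))) := fun x => by
    rw [← mul_assoc, ii]; simp only [add_mul, one_mul, mul_assoc]
  have ipip := h.ipip
  have ipip' : ∀ x, i * (p * (i * (p * x))) = p * (i * (p * (i * x))) := fun x => by
    simpa only [mul_assoc] using congrArg (· * x) ipip
  have qq := h'.pp
  have qq' : ∀ x, q * (q * x) = 0 := fun x => by rw [← mul_assoc, qq, zero_mul]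
  have jj := h'.ii
  have jj' : ∀ x, j * (j * x) = x + q * (j * (q * (j * x))) := fun x => by
    rw [← mul_assoc, jj]; simp only [add_mul, one_mul, mul_assoc]
  have jqjq := h'.ipip
  have jqjq' : ∀ x, j * (q * (j * (q * x))) = q * (j * (q * (j * x))) := fun x => by
    simpa only [mul_assoc] using congrArg (· * x) jqjq
  have pq' : ∀ x, q * (p * x) = p * (q * x) := fun x => by rw [← mul_assoc, pq, mul_assoc]
  have pj' : ∀ x, j * (p * x) = p * (j * x) := fun x => by rw [← mul_assoc, pj, mul_assoc]
  have iq' : ∀ x, q * (i * x) = i * (q * x) := fun x => by rw [← mul_assoc, iq, mul_assoc]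
  have ij' : ∀ x, j * (i * x) = i * (j * x) := fun x => by rw [← mul_assoc, ij, mul_assoc]
  constructor
  · simp only [mul_add, add_mul, pp, qq, pq, zero_add, add_zero, two]
  · simp only [mul_add, add_mul, mul_assoc, mul_one, one_mul, pp, pp', ii, ii', ipip, ipip', qq, qq', jj, jj', jqjq, jqjq',
      pq, pq', pj, pj', iq, iq', ij, ij', mul_zero, zero_mul, add_zero, zero_add]
    simp only [add_assoc, add_comm, add_left_comm, t, two, add_zero, zero_add]
  · simp only [mul_add, add_mul, mul_assoc, mul_one, one_mul, pp, pp', ii, ii', ipip, ipip', qq, qq', jj, jj', jqjq, jqjq',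
      pq, pq', pj, pj', iq, iq', ij, ij', mul_zero, zero_mul, add_zero, zero_add]
    simp only [add_assoc, add_comm, add_left_comm, t, two, add_zero, zero_add]

/-- The two bracketings of a triple tensor product carry homotopic involutions. -/
theorem IotaRel.assoc {p i q j r k : H} (h : IotaRel p i)
    (h' : IotaRel r k) (pq : q * p = p * q) (pj : j * p = p * j) (iq : q * i = i * q)
    (ij : j * i = i * j) (qr : r * q = q * r) (qk : k * q = q * k) (jr : r * j = j * r)
    (jk : k * j = j * k) :
    i * j * k + p * i * (j * q) * k + (p + q) * (i * j + p * i * (j * q)) * (k * r) =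
      i * (j * k + q * j * (k * r)) + p * i * ((j * k + q * j * (k * r)) * (q + r)) := by
  have pp' : ∀ x, p * (p * x) = 0 := fun x => by rw [← mul_assoc, h.pp, zero_mul]
  have rr := h'.pp
  have pq' : ∀ x, q * (p * x) = p * (q * x) := fun x => by rw [← mul_assoc, pq, mul_assoc]
  have pj' : ∀ x, j * (p * x) = p * (j * x) := fun x => by rw [← mul_assoc, pj, mul_assoc]
  have iq' : ∀ x, q * (i * x) = i * (q * x) := fun x => by rw [← mul_assoc, iq, mul_assoc]
  have ij' : ∀ x, j * (i * x) = i * (j * x) := fun x => by rw [← mul_assoc, ij, mul_assoc]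
  have qr' : ∀ x, r * (q * x) = q * (r * x) := fun x => by rw [← mul_assoc, qr, mul_assoc]
  have qk' : ∀ x, k * (q * x) = q * (k * x) := fun x => by rw [← mul_assoc, qk, mul_assoc]
  have jr' : ∀ x, r * (j * x) = j * (r * x) := fun x => by rw [← mul_assoc, jr, mul_assoc]
  have jk' : ∀ x, k * (j * x) = j * (k * x) := fun x => by rw [← mul_assoc, jk, mul_assoc]
  simp only [mul_add, add_mul, mul_assoc, pp', rr, pq, pq', pj, pj', iq, iq', ij, ij', qr, qr',
    qk, qk', jr, jr', jk, jk', mul_zero, zero_mul, add_zero, zero_add]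
  abel

/-- The map `1 + ιΦι ⊗ Φ` intertwines the two involutions `ι ⊗ ι + Φι ⊗ ιΦ` and
`ι ⊗ ι + ιΦ ⊗ Φι`. -/
theorem IotaRel.comm {p i q j : H} (h : IotaRel p i) (pq : q * p = p * q) (pj : j * p = p * j) (iq : q * i = i * q)
    (ij : j * i = i * j) :
    (i * j + i * p * (q * j)) * (1 + i * p * i * q) =
      (1 + i * p * i * q) * (i * j + p * i * (j * q)) := by
  have pp := h.pp
  have pp' : ∀ x, p * (p * x) = 0 := fun x => by rw [← mul_assoc, pp, zero_mul]
  have ii := h.ii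
  have ii' : ∀ x, i * (i * x) = x + p * (i * (p * (i * x))) := fun x => by
    rw [← mul_assoc, ii]; simp only [add_mul, one_mul, mul_assoc]
  have ipip' : ∀ x, i * (p * (i * (p * x))) = p * (i * (p * (i * x))) := fun x => by
    simpa only [mul_assoc] using congrArg (· * x) h.ipip
  have pq' : ∀ x, q * (p * x) = p * (q * x) := fun x => by rw [← mul_assoc, pq, mul_assoc]
  have pj' : ∀ x, j * (p * x) = p * (j * x) := fun x => by rw [← mul_assoc, pj, mul_assoc]
  have iq' : ∀ x, q * (i * x) = i * (q * x) := fun x => by rw [← mul_assoc, iq, mul_assoc]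
  have ij' : ∀ x, j * (i * x) = i * (j * x) := fun x => by rw [← mul_assoc, ij, mul_assoc]
  simp only [mul_add, add_mul, mul_assoc, mul_one, one_mul, pp', ii', ipip', pq, pq', pj, pj',
    iq, iq', ij, ij', mul_zero, zero_mul, add_zero, zero_add]

/-- The endomorphism `ιΦι` of a tensor product. -/
theorem IotaRel.psi_tensor (two : ∀ x : H, x + x = 0) {p i q j : H} (h : IotaRel p i)
    (h' : IotaRel q j) (pq : q * p = p * q) (pj : j * p = p * j) (iq : q * i = i * q)
    (ij : j * i = i * j) :
    i * p * i + j * q * j =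
      (i * j + p * i * (j * q)) * (p + q) * (i * j + p * i * (j * q)) := by
  have t : ∀ x y : H, x + (x + y) = y := fun x y => by rw [← add_assoc, two, zero_add]
  have pp := h.pp
  have pp' : ∀ x, p * (p * x) = 0 := fun x => by rw [← mul_assoc, pp, zero_mul]
  have ii := h.ii
  have ii' : ∀ x, i * (i * x) = x + p * (i * (p * (i * x))) := fun x => by
    rw [← mul_assoc, ii]; simp only [add_mul, one_mul, mul_assoc]
  have ipip := h.ipip
  have ipip' : ∀ x, i * (p * (i * (p * x))) = p * (i * (p * (i * x))) := fun x => by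
    simpa only [mul_assoc] using congrArg (· * x) ipip
  have qq := h'.pp
  have qq' : ∀ x, q * (q * x) = 0 := fun x => by rw [← mul_assoc, qq, zero_mul]
  have jj := h'.ii
  have jj' : ∀ x, j * (j * x) = x + q * (j * (q * (j * x))) := fun x => by
    rw [← mul_assoc, jj]; simp only [add_mul, one_mul, mul_assoc]
  have jqjq := h'.ipip
  have jqjq' : ∀ x, j * (q * (j * (q * x))) = q * (j * (q * (j * x))) := fun x => by
    simpa only [mul_assoc] using congrArg (· * x) jqjq
  have pq' : ∀ x, q * (p * x) = p * (q * x) := fun x => by rw [← mul_assoc, pq, mul_assoc]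
  have pj' : ∀ x, j * (p * x) = p * (j * x) := fun x => by rw [← mul_assoc, pj, mul_assoc]
  have iq' : ∀ x, q * (i * x) = i * (q * x) := fun x => by rw [← mul_assoc, iq, mul_assoc]
  have ij' : ∀ x, j * (i * x) = i * (j * x) := fun x => by rw [← mul_assoc, ij, mul_assoc]
  simp only [mul_add, add_mul, mul_assoc, mul_one, one_mul, pp, pp', ii, ii', ipip, ipip', qq,
    qq', jj, jj', jqjq, jqjq', pq, pq', pj, pj', iq, iq', ij, ij', mul_zero, zero_mul, add_zero,
    zero_add]
  simp only [add_assoc, add_comm, add_left_comm, t, two, add_zero, zero_add]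

theorem IotaRel.pow_four (two : ∀ x : H, x + x = 0) {p i : H} (h : IotaRel p i) :
    i * (i * i * i) = 1 ∧ i * i * i * i = 1 := by
  have t : ∀ x y : H, x + (x + y) = y := fun x y => by rw [← add_assoc, two, zero_add]
  have pp := h.pp
  have pp' : ∀ x, p * (p * x) = 0 := fun x => by rw [← mul_assoc, pp, zero_mul]
  have ii := h.ii
  have ii' : ∀ x, i * (i * x) = x + p * (i * (p * (i * x))) := fun x => by
    rw [← mul_assoc, ii]; simp only [add_mul, one_mul, mul_assoc]
  have ipip := h.ipip
  have ipip' : ∀ x, i * (p * (i * (p * x))) = p * (i * (p * (i * x))) := fun x => by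
    simpa only [mul_assoc] using congrArg (· * x) ipip
  constructor <;>
  · simp only [mul_add, add_mul, mul_assoc, mul_one, one_mul, pp, pp', ii, ii', ipip, ipip',
      mul_zero, zero_mul, add_zero, zero_add]
    simp only [add_assoc, add_comm, add_left_comm, t, two, add_zero, zero_add]

end Words
/-- The field with two elements. -/
abbrev F2 : Type := ZMod 2

/-- The bidegree `(A, M)` (Alexander and Maslov gradings) of the formal variable `U`. -/
def degU : ℤ × ℤ := (-1, -2)

/-- The action of a skew-graded map on bidegrees: it exchanges the two gradings `M` and `M - 2A`. -/
def skew (x : ℤ × ℤ) : ℤ × ℤ := (-x.1, x.2 - 2 * x.1)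

section Homog

variable {I J K I' J' : Type*}

/-- An `𝔽₂[U]`-linear map between free modules with homogeneous bases `I`, `J` (of bidegrees
`degI`, `degJ`) is homogeneous of bidegree `s`; here `U ^ k` times the basis vector `j` has
bidegree `degJ j + k • degU`. -/
def IsHomog (degI : I → ℤ × ℤ) (degJ : J → ℤ × ℤ) (s : ℤ × ℤ) (f : Matrix J I F2[X]) : Prop :=
  ∀ j i (k : ℕ), (f j i).coeff k ≠ 0 → degJ j + k • degU = degI i + s

/-- The same notion over `𝔽₂[U, U⁻¹]`. -/
def IsHomogLoc (degI : I → ℤ × ℤ) (degJ : J → ℤ × ℤ) (s : ℤ × ℤ)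
    (f : Matrix J I F2[T;T⁻¹]) : Prop :=
  ∀ j i (k : ℤ), (f j i).coeff k ≠ 0 → degJ j + k • degU = degI i + s

/-- Reduction of a map modulo `U`. -/
def hat (f : Matrix J I F2[X]) : Matrix J I F2 := f.map (constantCoeff : F2[X] →+* F2)

/-- Localization of a map at `U`. -/
def loc (f : Matrix J I F2[X]) : Matrix J I F2[T;T⁻¹] := f.map (toLaurent : F2[X] →+* F2[T;T⁻¹])

/-- The entrywise formal derivative with respect to `U`. -/
def formalDeriv (f : Matrix J I F2[X]) : Matrix J I F2[X] := f.map derivative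

end Homog

/-- A bigraded chain complex of finitely generated free `𝔽₂[U]`-modules, described by a homogeneous
basis `gen` (every finitely generated free bigraded `𝔽₂[U]`-module has one; maps are not required
to respect it) and the matrix of its differential, which preserves the Alexander grading and lowers
the Maslov grading by one. -/
structure BigradedComplex where
  gen : Type
  [fintype_gen : Fintype gen]
  [decEq_gen : DecidableEq gen]
  deg : gen → ℤ × ℤ
  d : Matrix gen gen F2[X]
  d_sq : d * d = 0
  d_homog : IsHomog deg deg (0, -1) d

attribute [instance] BigradedComplex.fintype_gen BigradedComplex.decEq_gen

namespace BigradedComplex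

/-- The differential of the hat-flavored truncation `C / U`. -/
def dHat (C : BigradedComplex) : Matrix C.gen C.gen F2 := hat C.d

/-- The differential of the localization `U⁻¹C`. -/
def dLoc (C : BigradedComplex) : Matrix C.gen C.gen F2[T;T⁻¹] := loc C.d

/-- The map `Φ` on the hat-flavored truncation: the formal derivative of the differential with
respect to `U`, reduced modulo `U`. -/
def phi (C : BigradedComplex) : Matrix C.gen C.gen F2 := hat (formalDeriv C.d)

end BigradedComplex

/-- A horizontal almost `ι_K`-complex: a bigraded complex `C` over `𝔽₂[U]` together with a
skew-graded homotopy equivalence `ι` of `C / U` such that `U⁻¹C ≃ 𝔽₂[U, U⁻¹]`,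
`ΦιΦι ∼ ιΦιΦ`, `ι² ∼ 1 + ΦιΦι`, and `ιΦι` lifts up to homotopy to a chain map of `C`. -/
structure HorizontalComplex extends BigradedComplex where
  /-- the involution on the hat-flavored truncation -/
  iota : Matrix gen gen F2
  iota_equiv : IsHomotopyEquiv toBigradedComplex.dHat toBigradedComplex.dHat iota
  /-- `U⁻¹C` is homotopy equivalent, as a bigraded complex, to `𝔽₂[U, U⁻¹]` with its unit in
  bidegree `(0, 0)` and with zero differential -/
  localization : ∃ (f : Matrix Unit gen F2[T;T⁻¹]) (g : Matrix gen Unit F2[T;T⁻¹]),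
    IsHomogLoc deg (fun _ => 0) 0 f ∧ IsHomogLoc (fun _ => 0) deg 0 g ∧
      IsHomotopyInverse toBigradedComplex.dLoc 0 f g
  iota_skew : ∀ j i, iota j i ≠ 0 → deg j = skew (deg i)
  iota_comm : Homotopic toBigradedComplex.dHat toBigradedComplex.dHat
    (toBigradedComplex.phi * iota * toBigradedComplex.phi * iota)
    (iota * toBigradedComplex.phi * iota * toBigradedComplex.phi)
  iota_sq : Homotopic toBigradedComplex.dHat toBigradedComplex.dHat
    (iota * iota) (1 + toBigradedComplex.phi * iota * toBigradedComplex.phi * iota)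
  /-- `ιΦι`, a map of bidegree `(-1, -1)`, lifts up to homotopy to a chain map of `C` -/
  psi_lift : ∃ f : Matrix gen gen F2[X], IsHomog deg deg (-1, -1) f ∧ IsChainMap d d f ∧
    Homotopic toBigradedComplex.dHat toBigradedComplex.dHat
      (hat f) (iota * toBigradedComplex.phi * iota)

/-- An almost `ι_K`-local map: a degree-preserving chain map over `𝔽₂[U]` whose localization is a
homotopy equivalence and whose truncation commutes with the involutions up to homotopy. -/
structure IsAlmostLocal (C D : HorizontalComplex) (f : Matrix D.gen C.gen F2[X]) : Prop where
  homog : IsHomog C.deg D.deg 0 f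
  chain : IsChainMap C.d D.d f
  isLocal : IsHomotopyEquiv C.dLoc D.dLoc (loc f)
  comm : Homotopic C.dHat D.dHat (D.iota * hat f) (hat f * C.iota)

section HomogLemmas

variable {I J K I' J' : Type*} {dI : I → ℤ × ℤ} {dJ : J → ℤ × ℤ} {dK : K → ℤ × ℤ}
  {dI' : I' → ℤ × ℤ} {dJ' : J' → ℤ × ℤ}

theorem IsHomog.add {s : ℤ × ℤ} {f g : Matrix J I F2[X]} (hf : IsHomog dI dJ s f)
    (hg : IsHomog dI dJ s g) : IsHomog dI dJ s (f + g) := by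
  intro j i k h
  by_cases h1 : (f j i).coeff k = 0
  · exact hg j i k (by simpa [h1] using h)
  · exact hf j i k h1

theorem IsHomog.one [DecidableEq I] : IsHomog dI dI 0 (1 : Matrix I I F2[X]) := by
  intro j i k h
  by_cases hji : j = i
  · subst hji
    by_cases hk : k = 0
    · simp [hk]
    · simp [Polynomial.coeff_one, hk] at h
  · simp [Matrix.one_apply_ne hji] at h

theorem IsHomog.mul [Fintype J] {s t : ℤ × ℤ} {f : Matrix J I F2[X]} {g : Matrix K J F2[X]}
    (hg : IsHomog dJ dK t g) (hf : IsHomog dI dJ s f) : IsHomog dI dK (s + t) (g * f) := by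
  intro l i k h
  rw [Matrix.mul_apply, Polynomial.finsetSum_coeff] at h
  obtain ⟨j, -, hj⟩ := Finset.exists_ne_zero_of_sum_ne_zero h
  rw [Polynomial.coeff_mul] at hj
  obtain ⟨⟨a, b⟩, hab, h2⟩ := Finset.exists_ne_zero_of_sum_ne_zero hj
  have h3 := hg l j a (left_ne_zero_of_mul h2)
  have h4 := hf j i b (right_ne_zero_of_mul h2)
  rw [Finset.HasAntidiagonal.mem_antidiagonal] at hab
  simp only at hab
  rw [← hab, add_smul, ← add_assoc, h3, ← add_assoc, ← h4]
  abel

theorem IsHomog.kronecker {s t : ℤ × ℤ} {f : Matrix J I F2[X]} {g : Matrix J' I' F2[X]}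
    (hf : IsHomog dI dJ s f) (hg : IsHomog dI' dJ' t g) :
    IsHomog (fun x : I × I' => dI x.1 + dI' x.2) (fun x : J × J' => dJ x.1 + dJ' x.2) (s + t)
      (f ⊗ₖ g) := by
  rintro ⟨j, j'⟩ ⟨i, i'⟩ k h
  rw [Matrix.kronecker_apply, Polynomial.coeff_mul] at h
  obtain ⟨⟨a, b⟩, hab, h2⟩ := Finset.exists_ne_zero_of_sum_ne_zero h
  have h3 := hf j i a (left_ne_zero_of_mul h2)
  have h4 := hg j' i' b (right_ne_zero_of_mul h2)
  rw [Finset.HasAntidiagonal.mem_antidiagonal] at hab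
  simp only at hab ⊢
  rw [← hab, add_smul]
  calc _ = (dJ j + a • degU) + (dJ' j' + b • degU) := by abel
    _ = _ := by rw [h3, h4]; abel

theorem IsHomogLoc.kronecker {s t : ℤ × ℤ} {f : Matrix J I F2[T;T⁻¹]}
    {g : Matrix J' I' F2[T;T⁻¹]} (hf : IsHomogLoc dI dJ s f) (hg : IsHomogLoc dI' dJ' t g) :
    IsHomogLoc (fun x : I × I' => dI x.1 + dI' x.2) (fun x : J × J' => dJ x.1 + dJ' x.2) (s + t)
      (f ⊗ₖ g) := by
  rintro ⟨j, j'⟩ ⟨i, i'⟩ k h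
  rw [Matrix.kronecker_apply] at h
  have h' := AddMonoidAlgebra.support_coeff_mul_subset _ _ (Finsupp.mem_support_iff.2 h)
  obtain ⟨a, ha, b, hb, hab⟩ := Finset.mem_add.1 h'
  have h3 := hf j i a (Finsupp.mem_support_iff.1 ha)
  have h4 := hg j' i' b (Finsupp.mem_support_iff.1 hb)
  simp only at hab ⊢
  rw [← hab, add_smul]
  calc _ = (dJ j + a • degU) + (dJ' j' + b • degU) := by abel
    _ = _ := by rw [h3, h4]; abel

theorem IsHomog.transpose {s : ℤ × ℤ} {f : Matrix J I F2[X]} (hf : IsHomog dI dJ s f) :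
    IsHomog (fun j => -dJ j) (fun i => -dI i) s fᵀ := by
  intro i j k h
  have := hf j i k h
  rw [← sub_eq_zero] at this ⊢
  rw [← this]
  simp only
  abel

theorem IsHomogLoc.transpose {s : ℤ × ℤ} {f : Matrix J I F2[T;T⁻¹]}
    (hf : IsHomogLoc dI dJ s f) : IsHomogLoc (fun j => -dJ j) (fun i => -dI i) s fᵀ := by
  intro i j k h
  have := hf j i k h
  rw [← sub_eq_zero] at this ⊢
  rw [← this]
  simp only
  abel

theorem IsHomog.formalDeriv {f : Matrix J I F2[X]} (hf : IsHomog dI dJ (0, -1) f) :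
    IsHomog dI dJ (1, 1) (formalDeriv f) := by
  intro j i k h
  have h1 : (f j i).coeff (k + 1) ≠ 0 := by
    intro h0
    apply h
    simp [HorizontalIota.formalDeriv, Polynomial.coeff_derivative, h0]
  have := hf j i (k + 1) h1
  rw [add_smul, one_smul, ← add_assoc, ← eq_sub_iff_add_eq] at this
  rw [this, add_sub_assoc]
  rfl

theorem IsHomog.hat {s : ℤ × ℤ} {f : Matrix J I F2[X]} (hf : IsHomog dI dJ s f) {j : J} {i : I}
    (h : hat f j i ≠ 0) : dJ j = dI i + s := by
  simpa using hf j i 0 h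

end HomogLemmas

section MapLemmas

variable {I J K : Type*} [Fintype I] [Fintype J] [Fintype K]

theorem hat_mul (f : Matrix K J F2[X]) (g : Matrix J I F2[X]) : hat (f * g) = hat f * hat g :=
  Matrix.map_mul

theorem loc_mul (f : Matrix K J F2[X]) (g : Matrix J I F2[X]) : loc (f * g) = loc f * loc g :=
  Matrix.map_mul

theorem hat_add (f g : Matrix J I F2[X]) : hat (f + g) = hat f + hat g :=
  Matrix.map_add _ (map_add _) _ _

theorem loc_add (f g : Matrix J I F2[X]) : loc (f + g) = loc f + loc g :=
  Matrix.map_add _ (map_add _) _ _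

theorem hat_one [DecidableEq I] : hat (1 : Matrix I I F2[X]) = 1 :=
  Matrix.map_one _ (map_zero _) (map_one _)

theorem loc_one [DecidableEq I] : loc (1 : Matrix I I F2[X]) = 1 :=
  Matrix.map_one _ (map_zero _) (map_one _)

theorem hat_transpose (f : Matrix J I F2[X]) : hat fᵀ = (hat f)ᵀ := rfl

theorem loc_transpose (f : Matrix J I F2[X]) : loc fᵀ = (loc f)ᵀ := rfl

theorem formalDeriv_transpose (f : Matrix J I F2[X]) : formalDeriv fᵀ = (formalDeriv f)ᵀ := rfl

theorem hat_kronecker {I' J' : Type*} (f : Matrix J I F2[X]) (g : Matrix J' I' F2[X]) :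
    hat (f ⊗ₖ g) = hat f ⊗ₖ hat g := by
  ext ⟨a, b⟩ ⟨c, e⟩
  simp [hat]

theorem loc_kronecker {I' J' : Type*} (f : Matrix J I F2[X]) (g : Matrix J' I' F2[X]) :
    loc (f ⊗ₖ g) = loc f ⊗ₖ loc g := by
  ext1 ⟨a, b⟩ ⟨c, e⟩
  simp only [loc, Matrix.map_apply, Matrix.kronecker_apply, map_mul]

theorem hat_tensorD [DecidableEq I] [DecidableEq J] (f : Matrix I I F2[X])
    (g : Matrix J J F2[X]) : hat (tensorD f g) = tensorD (hat f) (hat g) := by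
  simp only [tensorD, hat_add, hat_kronecker, hat_one]

theorem loc_tensorD [DecidableEq I] [DecidableEq J] (f : Matrix I I F2[X])
    (g : Matrix J J F2[X]) : loc (tensorD f g) = tensorD (loc f) (loc g) := by
  simp only [tensorD, loc_add, loc_kronecker, loc_one]

theorem formalDeriv_add (f g : Matrix J I F2[X]) :
    formalDeriv (f + g) = formalDeriv f + formalDeriv g := by
  ext1 i j; simp [formalDeriv]

theorem formalDeriv_mul (f : Matrix K J F2[X]) (g : Matrix J I F2[X]) :
    formalDeriv (f * g) = formalDeriv f * g + f * formalDeriv g := by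
  ext1 i j
  simp only [formalDeriv, Matrix.map_apply, Matrix.mul_apply, Matrix.add_apply, derivative_sum,
    derivative_mul, Finset.sum_add_distrib]

theorem formalDeriv_tensorD [DecidableEq I] [DecidableEq J] (f : Matrix I I F2[X])
    (g : Matrix J J F2[X]) :
    formalDeriv (tensorD f g) = tensorD (formalDeriv f) (formalDeriv g) := by
  ext1 ⟨a, b⟩ ⟨c, e⟩
  by_cases h1 : a = c <;> by_cases h2 : b = e <;>
    simp [formalDeriv, tensorD, Matrix.one_apply, h1, h2]

instance : CharP F2[T;T⁻¹] 2 :=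
  charP_of_injective_ringHom (f := (toLaurent : F2[X] →+* F2[T;T⁻¹])) toLaurent_injective 2

/-- The second divided derivative, which is a null-homotopy of `Φ²`. -/
theorem formalDeriv_sq_homotopic {d : Matrix I I F2[X]} (h : d * d = 0) :
    Homotopic d d (formalDeriv d * formalDeriv d) 0 := by
  refine ⟨d.map (hasseDeriv 2), ?_⟩
  have key : (d * d).map (hasseDeriv 2) = d.map (hasseDeriv 2) * d +
      formalDeriv d * formalDeriv d + d * d.map (hasseDeriv 2) := by
    ext1 i j
    simp only [formalDeriv, Matrix.map_apply, Matrix.mul_apply, Matrix.add_apply, map_sum,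
      hasseDeriv_mul, ← Finset.sum_add_distrib]
    refine Finset.sum_congr rfl fun x _ => ?_
    rw [show Finset.HasAntidiagonal.antidiagonal 2 = {(0, 2), (1, 1), (2, 0)} from rfl]
    simp [hasseDeriv_one', hasseDeriv_zero']
    ring
  have h0 : (0 : Matrix I I F2[X]).map (hasseDeriv 2) = 0 := by ext1; simp
  rw [h, h0] at key
  rw [zero_add]
  apply eq_of_add_zero
  rw [key]
  abel

theorem formalDeriv_chain {d : Matrix I I F2[X]} (h : d * d = 0) :
    IsChainMap d d (formalDeriv d) := by
  have := formalDeriv_mul d d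
  have h0 : formalDeriv (0 : Matrix I I F2[X]) = 0 := by ext1; simp [formalDeriv]
  rw [h, h0] at this
  exact (eq_of_add_zero this.symm).symm

/-- The truncation of a chain map commutes with `Φ` up to homotopy. -/
theorem phi_natural {dC : Matrix I I F2[X]} {dD : Matrix J J F2[X]} {f : Matrix J I F2[X]}
    (hf : IsChainMap dC dD f) :
    Homotopic dC dD (formalDeriv dD * f) (f * formalDeriv dC) := by
  refine ⟨formalDeriv f, ?_⟩
  have h1 := formalDeriv_mul dD f
  have h2 := formalDeriv_mul f dC
  rw [hf, h2] at h1
  apply eq_of_add_zero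
  calc _ = (formalDeriv dD * f + dD * formalDeriv f) + (formalDeriv f * dC + f * formalDeriv dC) := by
        abel
    _ = 0 := by rw [← h1, add_self_zero]

end MapLemmas

section HatRel

variable {I J K : Type*} [Fintype I] [Fintype J] [Fintype K] [DecidableEq I] [DecidableEq J]
  [DecidableEq K]

/-- The relations, up to homotopy, between `Φ` and `ι` on a hat-flavored truncation. -/
structure HatRel (d φ ι : Matrix I I F2) : Prop where
  chain_phi : IsChainMap d d φ
  chain_iota : IsChainMap d d ι
  phi_sq : Homotopic d d (φ * φ) 0
  iota_sq : Homotopic d d (ι * ι) (1 + φ * ι * φ * ι)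
  iota_comm : Homotopic d d (φ * ι * φ * ι) (ι * φ * ι * φ)

/-- The homotopy class of a chain endomorphism. -/
def cls {d f : Matrix I I F2} (h : IsChainMap d d f) : (htpyCon d).Quotient :=
  ((⟨f, mem_chainEnd.2 h⟩ : chainEnd d) : (htpyCon d).Quotient)

theorem cls_eq {d f g : Matrix I I F2} {hf : IsChainMap d d f} {hg : IsChainMap d d g} :
    cls hf = cls hg ↔ Homotopic d d f g := htpyCon_iff _ _

theorem cls_mul {d f g : Matrix I I F2} (hf : IsChainMap d d f) (hg : IsChainMap d d g) :
    cls hf * cls hg = cls (hf.mul hg) := rfl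

theorem cls_add {d f g : Matrix I I F2} (hf : IsChainMap d d f) (hg : IsChainMap d d g) :
    cls hf + cls hg = cls (hf.add hg) := rfl

theorem IsChainMap.zero {d : Matrix I I F2} : IsChainMap d d 0 := by simp [IsChainMap]

theorem cls_one {d : Matrix I I F2} : cls (IsChainMap.one d) = 1 := rfl

theorem cls_zero {d : Matrix I I F2} : cls (IsChainMap.zero (d := d)) = 0 := rfl

theorem cls_two {d : Matrix I I F2} (x : (htpyCon d).Quotient) : x + x = 0 := by
  induction x using Quotient.inductionOn' with
  | h a =>
    exact (htpyCon_iff (a + a) 0).2 (Homotopic.of_eq (add_self_zero a.1))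

theorem HatRel.iotaRel {d φ ι : Matrix I I F2} (h : HatRel d φ ι) :
    IotaRel (cls h.chain_phi) (cls h.chain_iota) where
  pp := by
    rw [cls_mul, ← cls_zero, cls_eq]; exact h.phi_sq
  ii := by
    simp only [cls_mul, ← cls_one, cls_add, cls_eq]
    simpa only [Matrix.mul_assoc] using h.iota_sq
  ipip := by
    simp only [cls_mul, ← cls_one, cls_add, cls_eq]
    simpa only [Matrix.mul_assoc] using h.iota_comm.symm

theorem HatRel.of_iotaRel {d φ ι : Matrix I I F2} (h1 : IsChainMap d d φ)
    (h2 : IsChainMap d d ι) (h : IotaRel (cls h1) (cls h2)) : HatRel d φ ι where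
  chain_phi := h1
  chain_iota := h2
  phi_sq := by
    have := h.pp
    rwa [cls_mul, ← cls_zero, cls_eq] at this
  iota_sq := by
    have := h.ii
    simp only [cls_mul, ← cls_one, cls_add, cls_eq] at this
    simpa only [Matrix.mul_assoc] using this
  iota_comm := by
    have := h.ipip
    simp only [cls_mul, ← cls_one, cls_add, cls_eq] at this
    simpa only [Matrix.mul_assoc] using this.symm

theorem HatRel.left {d φ ι : Matrix I I F2} (h : HatRel d φ ι) (d' : Matrix J J F2) :
    HatRel (tensorD d d') (φ ⊗ₖ (1 : Matrix J J F2)) (ι ⊗ₖ (1 : Matrix J J F2)) where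
  chain_phi := h.chain_phi.kronecker (IsChainMap.one d')
  chain_iota := h.chain_iota.kronecker (IsChainMap.one d')
  phi_sq := by
    simpa [← Matrix.mul_kronecker_mul] using h.phi_sq.kronecker_left (IsChainMap.one d')
  iota_sq := by
    simpa [← Matrix.mul_kronecker_mul, Matrix.add_kronecker] using
      h.iota_sq.kronecker_left (IsChainMap.one d')
  iota_comm := by
    simpa [← Matrix.mul_kronecker_mul] using h.iota_comm.kronecker_left (IsChainMap.one d')

theorem HatRel.right {d φ ι : Matrix I I F2} (h : HatRel d φ ι) (d' : Matrix J J F2) :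
    HatRel (tensorD d' d) ((1 : Matrix J J F2) ⊗ₖ φ) ((1 : Matrix J J F2) ⊗ₖ ι) where
  chain_phi := (IsChainMap.one d').kronecker h.chain_phi
  chain_iota := (IsChainMap.one d').kronecker h.chain_iota
  phi_sq := by
    simpa [← Matrix.mul_kronecker_mul] using h.phi_sq.kronecker_right (IsChainMap.one d')
  iota_sq := by
    simpa [← Matrix.mul_kronecker_mul, Matrix.kronecker_add] using
      h.iota_sq.kronecker_right (IsChainMap.one d')
  iota_comm := by
    simpa [← Matrix.mul_kronecker_mul] using h.iota_comm.kronecker_right (IsChainMap.one d')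

theorem cls_commute {d f g : Matrix I I F2} (hf : IsChainMap d d f) (hg : IsChainMap d d g)
    (h : f * g = g * f) : cls hf * cls hg = cls hg * cls hf := by
  rw [cls_mul, cls_mul, cls_eq]; exact Homotopic.of_eq h

/-- The involution of a tensor product of two hat-flavored truncations. -/
def tensorIota (φ ι : Matrix I I F2) (ψ κ : Matrix J J F2) : Matrix (I × J) (I × J) F2 :=
  ι ⊗ₖ κ + (φ * ι) ⊗ₖ (κ * ψ)

theorem tensorIota_eq (φ ι : Matrix I I F2) (ψ κ : Matrix J J F2) :
    tensorIota φ ι ψ κ = (ι ⊗ₖ (1 : Matrix J J F2)) * ((1 : Matrix I I F2) ⊗ₖ κ) +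
      (φ ⊗ₖ (1 : Matrix J J F2)) * (ι ⊗ₖ (1 : Matrix J J F2)) *
        (((1 : Matrix I I F2) ⊗ₖ κ) * ((1 : Matrix I I F2) ⊗ₖ ψ)) := by
  simp [tensorIota, ← Matrix.mul_kronecker_mul]

theorem HatRel.tensor {d φ ι : Matrix I I F2} {d' ψ κ : Matrix J J F2} (h : HatRel d φ ι)
    (h' : HatRel d' ψ κ) : HatRel (tensorD d d') (tensorD φ ψ) (tensorIota φ ι ψ κ) := by
  have a := h.left d'
  have b := h'.right d
  rw [tensorIota_eq, tensorD.eq_def φ ψ]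
  refine HatRel.of_iotaRel (a.chain_phi.add b.chain_phi)
    ((a.chain_iota.mul b.chain_iota).add
      ((a.chain_phi.mul a.chain_iota).mul (b.chain_iota.mul b.chain_phi))) ?_
  refine IotaRel.tensor cls_two a.iotaRel b.iotaRel ?_ ?_ ?_ ?_ <;>
  · refine cls_commute _ _ ?_
    simp [← Matrix.mul_kronecker_mul]

theorem HatRel.psi_tensor {d φ ι : Matrix I I F2} {d' ψ κ : Matrix J J F2} (h : HatRel d φ ι)
    (h' : HatRel d' ψ κ) : Homotopic (tensorD d d') (tensorD d d')
      ((ι * φ * ι) ⊗ₖ (1 : Matrix J J F2) + (1 : Matrix I I F2) ⊗ₖ (κ * ψ * κ))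
      (tensorIota φ ι ψ κ * tensorD φ ψ * tensorIota φ ι ψ κ) := by
  have a := h.left d'
  have b := h'.right d
  have key := IotaRel.psi_tensor cls_two a.iotaRel b.iotaRel
    (cls_commute _ _ (by simp [← Matrix.mul_kronecker_mul]))
    (cls_commute _ _ (by simp [← Matrix.mul_kronecker_mul]))
    (cls_commute _ _ (by simp [← Matrix.mul_kronecker_mul]))
    (cls_commute _ _ (by simp [← Matrix.mul_kronecker_mul]))
  simp only [cls_mul, cls_add, cls_eq] at key
  rw [tensorIota_eq, tensorD.eq_def φ ψ]
  simpa only [← Matrix.mul_kronecker_mul, Matrix.one_mul, Matrix.mul_one] using key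

theorem HatRel.isHomotopyEquiv {d φ ι : Matrix I I F2} (h : HatRel d φ ι) :
    IsHomotopyEquiv d d ι := by
  have key := IotaRel.pow_four cls_two h.iotaRel
  simp only [cls_mul, ← cls_one, cls_eq] at key
  exact ⟨ι * ι * ι, h.chain_iota, (h.chain_iota.mul h.chain_iota).mul h.chain_iota, key.2, key.1⟩

theorem HatRel.comm {d φ ι : Matrix I I F2} {d' ψ κ : Matrix J J F2} (h : HatRel d φ ι)
    (h' : HatRel d' ψ κ) : Homotopic (tensorD d d') (tensorD d d')
      ((ι ⊗ₖ κ + (ι * φ) ⊗ₖ (ψ * κ)) * (1 + (ι * φ * ι) ⊗ₖ ψ))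
      ((1 + (ι * φ * ι) ⊗ₖ ψ) * tensorIota φ ι ψ κ) := by
  have a := h.left d'
  have b := h'.right d
  have key := IotaRel.comm a.iotaRel (q := cls b.chain_phi) (j := cls b.chain_iota)
    (cls_commute _ _ (by simp [← Matrix.mul_kronecker_mul]))
    (cls_commute _ _ (by simp [← Matrix.mul_kronecker_mul]))
    (cls_commute _ _ (by simp [← Matrix.mul_kronecker_mul]))
    (cls_commute _ _ (by simp [← Matrix.mul_kronecker_mul]))
  simp only [← cls_one, cls_mul, cls_add, cls_eq] at key
  rw [tensorIota.eq_def]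
  simpa only [← Matrix.mul_kronecker_mul, Matrix.one_mul, Matrix.mul_one] using key

theorem HatRel.assoc {d₁ φ₁ ι₁ : Matrix I I F2} {d₂ φ₂ ι₂ : Matrix J J F2}
    {d₃ φ₃ ι₃ : Matrix K K F2} (h₁ : HatRel d₁ φ₁ ι₁) (h₂ : HatRel d₂ φ₂ ι₂)
    (h₃ : HatRel d₃ φ₃ ι₃) :
    Homotopic (tensorD d₁ (tensorD d₂ d₃)) (tensorD d₁ (tensorD d₂ d₃))
      ((tensorIota (tensorD φ₁ φ₂) (tensorIota φ₁ ι₁ φ₂ ι₂) φ₃ ι₃).submatrix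
        (Equiv.prodAssoc I J K).symm (Equiv.prodAssoc I J K).symm)
      (tensorIota φ₁ ι₁ (tensorD φ₂ φ₃) (tensorIota φ₂ ι₂ φ₃ ι₃)) := by
  have a := h₁.left (tensorD d₂ d₃)
  have b := (h₂.left d₃).right d₁
  have c := (h₃.right d₂).right d₁
  have key := IotaRel.assoc a.iotaRel c.iotaRel (q := cls b.chain_phi) (j := cls b.chain_iota)
    (cls_commute _ _ (by simp [← Matrix.mul_kronecker_mul]))
    (cls_commute _ _ (by simp [← Matrix.mul_kronecker_mul]))
    (cls_commute _ _ (by simp [← Matrix.mul_kronecker_mul]))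
    (cls_commute _ _ (by simp [← Matrix.mul_kronecker_mul]))
    (cls_commute _ _ (by simp [← Matrix.mul_kronecker_mul]))
    (cls_commute _ _ (by simp [← Matrix.mul_kronecker_mul]))
    (cls_commute _ _ (by simp [← Matrix.mul_kronecker_mul]))
    (cls_commute _ _ (by simp [← Matrix.mul_kronecker_mul]))
  simp only [← cls_one, cls_mul, cls_add, cls_eq] at key
  simp only [← Matrix.mul_kronecker_mul, Matrix.one_mul, Matrix.mul_one, ← Matrix.kronecker_add, 
    ← Matrix.add_kronecker, Matrix.mul_add, Matrix.add_mul] at key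
  have hs : ∀ (A : Matrix I I F2) (B : Matrix J J F2) (C : Matrix K K F2),
      ((A ⊗ₖ B) ⊗ₖ C).submatrix (Equiv.prodAssoc I J K).symm (Equiv.prodAssoc I J K).symm =
        A ⊗ₖ (B ⊗ₖ C) := fun A B C => Matrix.kronecker_assoc A B C
  simp only [tensorIota, tensorD, ← Matrix.mul_kronecker_mul, Matrix.one_mul, Matrix.mul_one,
    Matrix.kronecker_add, Matrix.add_kronecker, Matrix.mul_add, Matrix.add_mul,
    Matrix.submatrix_add, Pi.add_apply, hs] at key ⊢
  convert key using 1

end HatRel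

section Reindex

variable {R : Type*} [CommRing R] {I J : Type*} [Fintype I] [Fintype J] [DecidableEq I]
  [DecidableEq J]

/-- The matrix of the bijection `e` of bases. -/
def permMat (R : Type*) [CommRing R] (e : I ≃ J) : Matrix J I R :=
  (1 : Matrix I I R).submatrix e.symm id

theorem mul_permMat (e : I ≃ J) (M : Matrix J J R) :
    M * permMat R e = permMat R e * M.submatrix e e := by
  ext j i
  obtain ⟨j, rfl⟩ := e.surjective j
  simp [permMat, Matrix.mul_apply, Matrix.one_apply, Equiv.symm_apply_eq]

theorem permMat_isHomotopyInverse (e : I ≃ J) {dC : Matrix I I R} {dD : Matrix J J R}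
    (h : dD.submatrix e e = dC) :
    IsHomotopyInverse dC dD (permMat R e) (permMat R e.symm) := by
  have h1 : permMat R e.symm * permMat R e = 1 := by
    ext i i'
    simp [permMat, Matrix.mul_apply, Matrix.one_apply, Equiv.symm_apply_eq]
  have h2 : permMat R e * permMat R e.symm = 1 := by
    ext i i'
    obtain ⟨i, rfl⟩ := e.surjective i
    obtain ⟨i', rfl⟩ := e.surjective i'
    simp [permMat, Matrix.mul_apply, Matrix.one_apply, Equiv.symm_apply_eq]
  refine ⟨?_, ?_, Homotopic.of_eq h1, Homotopic.of_eq h2⟩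
  · rw [IsChainMap, mul_permMat, h]
  · rw [IsChainMap, mul_permMat]
    congr 1
    rw [← h]
    ext; simp

theorem hat_permMat (e : I ≃ J) : hat (permMat F2[X] e) = permMat F2 e := by
  simp only [permMat, hat]
  rw [← Matrix.submatrix_map, Matrix.map_one _ (map_zero _) (map_one _)]

theorem loc_permMat (e : I ≃ J) : loc (permMat F2[X] e) = permMat F2[T;T⁻¹] e := by
  simp only [permMat, loc]
  rw [← Matrix.submatrix_map, Matrix.map_one _ (map_zero _) (map_one _)]

theorem permMat_homog (e : I ≃ J) {dI : I → ℤ × ℤ} {dJ : J → ℤ × ℤ}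
    (h : ∀ i, dJ (e i) = dI i) : IsHomog dI dJ 0 (permMat F2[X] e) := by
  intro j i k hk
  have := IsHomog.one (dI := dI) (e.symm j) i k hk
  rw [← h, Equiv.apply_symm_apply] at this
  exact this

end Reindex

namespace BigradedComplex

theorem phi_chain (C : BigradedComplex) : IsChainMap C.dHat C.dHat C.phi :=
  (formalDeriv_chain C.d_sq).map _

theorem phi_sq (C : BigradedComplex) : Homotopic C.dHat C.dHat (C.phi * C.phi) 0 := by
  have := (formalDeriv_sq_homotopic C.d_sq).map (constantCoeff : F2[X] →+* F2)
  rw [Matrix.map_mul, Matrix.map_zero _ (map_zero _)] at this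
  exact this

theorem phi_deg (C : BigradedComplex) {j i : C.gen} (h : C.phi j i ≠ 0) :
    C.deg j = C.deg i + (1, 1) :=
  C.d_homog.formalDeriv.hat h

/-- The tensor product of bigraded complexes over `𝔽₂[U]`. -/
@[reducible]
def tensor (C D : BigradedComplex) : BigradedComplex where
  gen := C.gen × D.gen
  deg x := C.deg x.1 + D.deg x.2
  d := tensorD C.d D.d
  d_sq := by
    simp only [tensorD, Matrix.mul_add, Matrix.add_mul, ← Matrix.mul_kronecker_mul,
      Matrix.one_mul, Matrix.mul_one, C.d_sq, D.d_sq]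
    simpa using add_self_zero (C.d ⊗ₖ D.d)
  d_homog := by
    have h1 := C.d_homog.kronecker (IsHomog.one (dI := D.deg))
    have h2 := (IsHomog.one (dI := C.deg)).kronecker D.d_homog
    rw [add_zero] at h1
    rw [zero_add] at h2
    exact h1.add h2

/-- The dual complex, with the dual basis. -/
@[reducible]
def dual (C : BigradedComplex) : BigradedComplex where
  gen := C.gen
  deg x := -C.deg x
  d := C.dᵀ
  d_sq := by rw [← Matrix.transpose_mul, C.d_sq, Matrix.transpose_zero]
  d_homog := C.d_homog.transpose

theorem tensor_dHat (C D : BigradedComplex) : (C.tensor D).dHat = tensorD C.dHat D.dHat :=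
  hat_tensorD _ _

theorem tensor_dLoc (C D : BigradedComplex) : (C.tensor D).dLoc = tensorD C.dLoc D.dLoc :=
  loc_tensorD _ _

theorem tensor_phi (C D : BigradedComplex) : (C.tensor D).phi = tensorD C.phi D.phi := by
  simp only [phi, formalDeriv_tensorD, hat_tensorD]

end BigradedComplex

namespace HorizontalComplex

theorem hatRel (C : HorizontalComplex) : HatRel C.dHat C.phi C.iota where
  chain_phi := C.phi_chain
  chain_iota := C.iota_equiv.choose_spec.chain_f
  phi_sq := C.phi_sq
  iota_sq := C.iota_sq
  iota_comm := C.iota_comm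

theorem skew_add (x y : ℤ × ℤ) : skew (x + y) = skew x + skew y := by
  ext <;> simp [skew] <;> ring

theorem phi_iota_deg (C : HorizontalComplex) {j i : C.gen} (h : (C.phi * C.iota) j i ≠ 0) :
    C.deg j = skew (C.deg i) + (1, 1) := by
  rw [Matrix.mul_apply] at h
  obtain ⟨x, -, hx⟩ := Finset.exists_ne_zero_of_sum_ne_zero h
  rw [C.phi_deg (left_ne_zero_of_mul hx), C.iota_skew _ _ (right_ne_zero_of_mul hx)]

theorem iota_phi_deg (C : HorizontalComplex) {j i : C.gen} (h : (C.iota * C.phi) j i ≠ 0) :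
    C.deg j = skew (C.deg i) + (-1, -1) := by
  rw [Matrix.mul_apply] at h
  obtain ⟨x, -, hx⟩ := Finset.exists_ne_zero_of_sum_ne_zero h
  rw [C.iota_skew _ _ (left_ne_zero_of_mul hx), C.phi_deg (right_ne_zero_of_mul hx), skew_add]
  rfl

/-- The tensor product of horizontal almost `ι_K`-complexes, with the involution
`ι ⊗ ι + Φι ⊗ ιΦ`. -/
@[reducible]
def tensor (C D : HorizontalComplex) : HorizontalComplex where
  toBigradedComplex := C.toBigradedComplex.tensor D.toBigradedComplex
  iota := tensorIota C.phi C.iota D.phi D.iota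
  iota_equiv := by
    rw [BigradedComplex.tensor_dHat]
    exact (C.hatRel.tensor D.hatRel).isHomotopyEquiv
  localization := by
    obtain ⟨f, g, hf, hg, hfg⟩ := C.localization
    obtain ⟨f', g', hf', hg', hfg'⟩ := D.localization
    let e : Unit × Unit ≃ Unit := Equiv.punitProd Unit
    have h0 : (0 : Matrix Unit Unit F2[T;T⁻¹]).submatrix e e = tensorD 0 0 := by
      simp [tensorD]
    refine ⟨permMat _ e * (f ⊗ₖ f'), (g ⊗ₖ g') * permMat _ e.symm, ?_, ?_, ?_⟩
    · have := hf.kronecker hf'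
      intro j i k hk
      have h1 := this ((), ()) i k (by
        convert hk using 3
        erw [Matrix.mul_apply]
        simp [permMat, Matrix.one_apply, e, Fintype.sum_prod_type])
      simpa using h1
    · have := hg.kronecker hg'
      intro j i k hk
      have h1 := this j ((), ()) k (by
        convert hk using 3
        erw [Matrix.mul_apply]
        simp [permMat, Matrix.one_apply, e, Fintype.sum_prod_type])
      simpa using h1
    · rw [BigradedComplex.tensor_dLoc]
      exact (hfg.kronecker hfg').comp (permMat_isHomotopyInverse e h0)
  iota_skew := by
    rintro ⟨j, j'⟩ ⟨i, i'⟩ h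
    simp only [skew_add]
    by_cases h1 : (C.iota ⊗ₖ D.iota) (j, j') (i, i') = 0
    · have h2 : ((C.phi * C.iota) ⊗ₖ (D.iota * D.phi)) (j, j') (i, i') ≠ 0 := by
        intro h2
        exact h (by rw [tensorIota, Matrix.add_apply, h1, h2, add_zero])
      rw [Matrix.kronecker_apply] at h2
      rw [C.phi_iota_deg (left_ne_zero_of_mul h2), D.iota_phi_deg (right_ne_zero_of_mul h2)]
      ext <;> simp <;> ring
    · rw [Matrix.kronecker_apply] at h1
      rw [C.iota_skew _ _ (left_ne_zero_of_mul h1), D.iota_skew _ _ (right_ne_zero_of_mul h1)]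
  iota_comm := by
    rw [BigradedComplex.tensor_dHat, BigradedComplex.tensor_phi]
    exact (C.hatRel.tensor D.hatRel).iota_comm
  iota_sq := by
    rw [BigradedComplex.tensor_dHat, BigradedComplex.tensor_phi]
    exact (C.hatRel.tensor D.hatRel).iota_sq
  psi_lift := by
    obtain ⟨f, hf, hf', hf''⟩ := C.psi_lift
    obtain ⟨g, hg, hg', hg''⟩ := D.psi_lift
    refine ⟨f ⊗ₖ 1 + 1 ⊗ₖ g, ?_, ?_, ?_⟩
    · have h1 := hf.kronecker (IsHomog.one (dI := D.deg))
      have h2 := (IsHomog.one (dI := C.deg)).kronecker hg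
      rw [add_zero] at h1
      rw [zero_add] at h2
      exact h1.add h2
    · exact (hf'.kronecker (IsChainMap.one _)).add ((IsChainMap.one _).kronecker hg')
    · rw [BigradedComplex.tensor_dHat, BigradedComplex.tensor_phi]
      refine Homotopic.trans ?_ (C.hatRel.psi_tensor D.hatRel)
      rw [hat_add, hat_kronecker, hat_kronecker, hat_one, hat_one]
      exact (hf''.kronecker_left (IsChainMap.one _)).add
        (hg''.kronecker_right (IsChainMap.one _))

/-- The dual complex with the dual involution. -/
@[reducible]
def dual (C : HorizontalComplex) : HorizontalComplex where
  toBigradedComplex := C.toBigradedComplex.dual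
  iota := C.iotaᵀ
  iota_equiv := by
    obtain ⟨g, hg⟩ := C.iota_equiv
    exact ⟨_, hg.transpose⟩
  localization := by
    obtain ⟨f, g, hf, hg, hfg⟩ := C.localization
    refine ⟨gᵀ, fᵀ, ?_, ?_, ?_⟩
    · simpa using hg.transpose
    · simpa using hf.transpose
    · have := hfg.symm.transpose
      rw [Matrix.transpose_zero] at this
      exact this
  iota_skew := by
    intro j i h
    have := C.iota_skew _ _ h
    change -C.deg j = skew (-C.deg i)
    rw [this]
    ext <;> simp [skew]
  iota_comm := by
    have := C.iota_comm.transpose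
    simp only [Matrix.transpose_mul, ← Matrix.mul_assoc] at this
    exact this.symm
  iota_sq := by
    have := (C.iota_sq.trans ((Homotopic.refl 1).add C.iota_comm)).transpose
    simp only [Matrix.transpose_mul, ← Matrix.mul_assoc, Matrix.transpose_add,
      Matrix.transpose_one] at this
    exact this
  psi_lift := by
    obtain ⟨f, hf, hf', hf''⟩ := C.psi_lift
    refine ⟨fᵀ, hf.transpose, hf'.transpose, ?_⟩
    have := hf''.transpose
    simp only [Matrix.transpose_mul, ← Matrix.mul_assoc] at this
    exact this

theorem one_homogLoc : IsHomogLoc (fun _ : Unit => 0) (fun _ : Unit => 0) 0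
    (1 : Matrix Unit Unit F2[T;T⁻¹]) := by
  intro j i k h
  have h' : (1 : F2[T;T⁻¹]).coeff k ≠ 0 := h
  rw [AddMonoidAlgebra.one_def, AddMonoidAlgebra.coeff_single, Finsupp.single_apply] at h'
  have hk : k = 0 := by
    by_contra hk
    exact h' (if_neg (Ne.symm hk))
  simp [hk]

/-- The complex `𝔽₂[U]` with its unit in bidegree `(0, 0)`. -/
@[reducible]
def trivialComplex : BigradedComplex where
  gen := Unit
  deg _ := 0
  d := 0
  d_sq := by simp
  d_homog := by intro j i k h; simp at h

theorem trivial_dLoc : trivialComplex.dLoc = 0 := by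
  ext1; simp [BigradedComplex.dLoc, loc]

theorem trivial_dHat : trivialComplex.dHat = 0 := by
  ext1; simp [BigradedComplex.dHat, hat]

theorem trivial_phi : trivialComplex.phi = 0 := by
  ext1; simp [BigradedComplex.phi, hat, formalDeriv]

/-- The trivial complex `C_O`: `𝔽₂[U]` with its unit in bidegree `(0, 0)` and the trivial
involution. -/
@[reducible]
def trivial : HorizontalComplex where
  toBigradedComplex := trivialComplex
  iota := 1
  iota_equiv := ⟨1, IsChainMap.one _, IsChainMap.one _, Homotopic.of_eq (by simp),
    Homotopic.of_eq (by simp)⟩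
  localization := by
    refine ⟨1, 1, one_homogLoc, one_homogLoc, ?_⟩
    rw [trivial_dLoc]
    exact ⟨IsChainMap.one _, IsChainMap.one _, Homotopic.of_eq (by simp),
      Homotopic.of_eq (by simp)⟩
  iota_skew := by intro j i _; rfl
  iota_comm := Homotopic.of_eq (by simp)
  iota_sq := Homotopic.of_eq (by rw [trivial_phi]; simp)
  psi_lift := by
    refine ⟨0, ?_, by simp [IsChainMap], Homotopic.of_eq ?_⟩
    · intro j i k h; simp at h
    · rw [trivial_phi]
      ext1; simp [hat]

/-- The matrix of the differential of the figure-eight complex: `∂a = Ub`, `∂c = Ud` and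
`∂b = ∂d = ∂x = 0`, in the basis `a, b, c, d, x`. -/
def figEightD : Matrix (Fin 5) (Fin 5) F2[X] :=
  !![0, 0, 0, 0, 0;
     X, 0, 0, 0, 0;
     0, 0, 0, 0, 0;
     0, 0, X, 0, 0;
     0, 0, 0, 0, 0]

/-- The bidegrees of `a, b, c, d, x`. -/
def figEightDeg : Fin 5 → ℤ × ℤ := ![(0, 0), (1, 1), (-1, -1), (0, 0), (0, 0)]

/-- The matrix of the involution: `a ↦ a + x`, `b ↦ c`, `c ↦ b`, `d ↦ d`, `x ↦ x + d`. -/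
def figEightIota : Matrix (Fin 5) (Fin 5) F2 :=
  !![1, 0, 0, 0, 0;
     0, 0, 1, 0, 0;
     0, 1, 0, 0, 0;
     0, 0, 0, 1, 1;
     1, 0, 0, 0, 1]

/-- The map `Φ`: `a ↦ b`, `c ↦ d`. -/
def figEightPhi : Matrix (Fin 5) (Fin 5) F2 :=
  !![0, 0, 0, 0, 0;
     1, 0, 0, 0, 0;
     0, 0, 0, 0, 0;
     0, 0, 1, 0, 0;
     0, 0, 0, 0, 0]

theorem hat_figEightD : hat figEightD = 0 := by
  ext1 i j; fin_cases i <;> fin_cases j <;> simp [hat, figEightD]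

theorem hat_formalDeriv_figEightD : hat (formalDeriv figEightD) = figEightPhi := by
  ext1 i j; fin_cases i <;> fin_cases j <;> simp [hat, formalDeriv, figEightD, figEightPhi]

/-- The bigraded complex underlying the figure-eight complex. -/
@[reducible]
def figEightComplex : BigradedComplex where
  gen := Fin 5
  deg := figEightDeg
  d := figEightD
  d_sq := by
    ext1 i j
    fin_cases i <;> fin_cases j <;> simp [figEightD, Matrix.mul_apply, Fin.sum_univ_five]
  d_homog := by
    intro j i k h
    have hX : (X : F2[X]).coeff k ≠ 0 → k = 1 := by
      intro h
      by_contra hk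
      exact h (by rw [Polynomial.coeff_X, if_neg (Ne.symm hk)])
    fin_cases i <;> fin_cases j <;> simp [figEightD] at h <;>
      · have := hX h
        subst this
        decide

theorem figEight_dHat : figEightComplex.dHat = 0 := hat_figEightD

theorem figEight_phi : figEightComplex.phi = figEightPhi := hat_formalDeriv_figEightD

theorem figEight_skew (j i : Fin 5) (h : figEightIota j i ≠ 0) :
    figEightDeg j = skew (figEightDeg i) := by
  revert h
  fin_cases i <;> fin_cases j <;> decide

theorem figEight_iota_sq : figEightIota * figEightIota =
    1 + figEightPhi * figEightIota * figEightPhi * figEightIota := by decide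

theorem figEight_iota_comm : figEightPhi * figEightIota * figEightPhi * figEightIota =
    figEightIota * figEightPhi * figEightIota * figEightPhi := by decide

theorem figEight_hatRel : HatRel figEightComplex.dHat figEightComplex.phi figEightIota := by
  rw [figEight_phi, figEight_dHat]
  exact ⟨by simp [IsChainMap], by simp [IsChainMap], Homotopic.of_eq (by decide),
    Homotopic.of_eq figEight_iota_sq, Homotopic.of_eq figEight_iota_comm⟩

/-- The figure-eight complex `C_E`. -/
@[reducible]
def figEight : HorizontalComplex where
  toBigradedComplex := figEightComplex
  iota := figEightIota
  iota_equiv := figEight_hatRel.isHomotopyEquiv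
  localization := by
    have hone : ∀ k : ℤ, (1 : F2[T;T⁻¹]).coeff k ≠ 0 → k = 0 := by
      intro k h'
      rw [AddMonoidAlgebra.one_def, AddMonoidAlgebra.coeff_single, Finsupp.single_apply] at h'
      by_contra hk
      exact h' (if_neg (Ne.symm hk))
    have hT : (T 1 * T (-1) : F2[T;T⁻¹]) = 1 := by rw [← T_add]; simp
    have hT' : (T (-1) * T 1 : F2[T;T⁻¹]) = 1 := by rw [← T_add]; simp
    have hd : figEightComplex.dLoc = !![0, 0, 0, 0, 0; T 1, 0, 0, 0, 0; 0, 0, 0, 0, 0;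
        0, 0, T 1, 0, 0; 0, 0, 0, 0, 0] := by
      ext1 i j
      fin_cases i <;> fin_cases j <;> simp [BigradedComplex.dLoc, loc, figEightD]
    rw [hd]
    refine ⟨Matrix.of fun _ => ![0, 0, 0, 0, 1], Matrix.of fun i _ => ![0, 0, 0, 0, 1] i,
      ?_, ?_, ?_⟩
    · intro j i k h
      fin_cases i <;> simp at h
      simp [hone k h, figEightDeg]
      rfl
    · intro j i k h
      fin_cases j <;> simp at h
      simp [hone k h, figEightDeg]
    · refine ⟨?_, ?_, ⟨!![0, T (-1), 0, 0, 0; 0, 0, 0, 0, 0; 0, 0, 0, T (-1), 0; 0, 0, 0, 0, 0;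
        0, 0, 0, 0, 0], ?_⟩, Homotopic.of_eq ?_⟩
      · ext1 i j
        fin_cases j <;> simp [Matrix.mul_apply, Fin.sum_univ_five]
      · ext1 i j
        fin_cases i <;> simp [Matrix.mul_apply, Fin.sum_univ_five]
      · ext1 i j
        fin_cases i <;> fin_cases j <;>
          simp [Matrix.mul_apply, Fin.sum_univ_five, hT, hT', CharTwo.add_self_eq_zero]
      · ext1 i j
        simp [Matrix.mul_apply, Fin.sum_univ_five]
  iota_skew := figEight_skew
  iota_comm := figEight_hatRel.iota_comm
  iota_sq := figEight_hatRel.iota_sq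
  psi_lift := by
    refine ⟨!![0, 0, 0, 0, 0; 0, 0, 0, 0, 0; 1, 0, 0, 0, 0; 0, 1, 0, 0, 0; 0, 0, 0, 0, 0],
      ?_, ?_, Homotopic.of_eq ?_⟩
    · intro j i k h
      have hX : (1 : F2[X]).coeff k ≠ 0 → k = 0 := by
        intro h
        by_contra hk
        exact h (by rw [Polynomial.coeff_one, if_neg hk])
      fin_cases i <;> fin_cases j <;> simp at h <;>
      · have := hX h
        subst this
        decide
    · ext1 i j
      fin_cases i <;> fin_cases j <;> simp [figEightD, Matrix.mul_apply, Fin.sum_univ_five]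
    · rw [figEight_phi]
      have : hat !![0, 0, 0, 0, 0; 0, 0, 0, 0, 0; 1, 0, 0, 0, 0; 0, 1, 0, 0, 0; 0, 0, 0, 0, 0] =
        !![0, 0, 0, 0, 0; 0, 0, 0, 0, 0; 1, 0, 0, 0, 0; 0, 1, 0, 0, 0; 0, 0, 0, 0, 0] := by
        ext1 i j
        fin_cases i <;> fin_cases j <;> simp [hat]
      rw [this]
      decide

end HorizontalComplex

theorem IsAlmostLocal.one (C : HorizontalComplex) : IsAlmostLocal C C 1 where
  homog := IsHomog.one
  chain := IsChainMap.one _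
  isLocal := by
    rw [loc_one]
    exact ⟨1, IsChainMap.one _, IsChainMap.one _, Homotopic.of_eq (by simp),
      Homotopic.of_eq (by simp)⟩
  comm := Homotopic.of_eq (by rw [hat_one]; simp)

theorem IsChainMap.hat {C D : BigradedComplex} {f : Matrix D.gen C.gen F2[X]}
    (h : IsChainMap C.d D.d f) : IsChainMap C.dHat D.dHat (hat f) := h.map _

theorem IsAlmostLocal.mul {C D E : HorizontalComplex} {f : Matrix D.gen C.gen F2[X]}
    {g : Matrix E.gen D.gen F2[X]} (hg : IsAlmostLocal D E g) (hf : IsAlmostLocal C D f) :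
    IsAlmostLocal C E (g * f) where
  homog := by simpa using hg.homog.mul hf.homog
  chain := hg.chain.mul hf.chain
  isLocal := by
    rw [loc_mul]
    exact hg.isLocal.comp hf.isLocal
  comm := by
    rw [hat_mul, ← Matrix.mul_assoc, Matrix.mul_assoc (hat g)]
    refine (Homotopic.mul_right hf.chain.hat hg.comm).trans ?_
    rw [Matrix.mul_assoc]
    exact Homotopic.mul_left hg.chain.hat hf.comm

/-- `C ≤ D` if there is an almost `ι_K`-local map from `C` to `D`. -/
instance : Preorder HorizontalComplex where
  le C D := ∃ f : Matrix D.gen C.gen F2[X], IsAlmostLocal C D f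
  le_refl C := ⟨1, IsAlmostLocal.one C⟩
  le_trans _ _ _ := fun ⟨_, hf⟩ ⟨_, hg⟩ => ⟨_, hg.mul hf⟩

namespace HorizontalComplex

theorem tensor_mono {C C' D D' : HorizontalComplex} (h : C ≤ C') (h' : D ≤ D') :
    C.tensor D ≤ C'.tensor D' := by
  obtain ⟨f, hf⟩ := h
  obtain ⟨g, hg⟩ := h'
  refine ⟨f ⊗ₖ g, ?_, hf.chain.kronecker hg.chain, ?_, ?_⟩
  · simpa using hf.homog.kronecker hg.homog
  · rw [BigradedComplex.tensor_dLoc, BigradedComplex.tensor_dLoc, loc_kronecker]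
    obtain ⟨f', hf'⟩ := hf.isLocal
    obtain ⟨g', hg'⟩ := hg.isLocal
    exact ⟨_, hf'.kronecker hg'⟩
  · have pf : Homotopic C.dHat C'.dHat (C'.phi * hat f) (hat f * C.phi) := by
      have := (phi_natural hf.chain).map (constantCoeff : F2[X] →+* F2)
      rwa [Matrix.map_mul, Matrix.map_mul] at this
    have pg : Homotopic D.dHat D'.dHat (D'.phi * hat g) (hat g * D.phi) := by
      have := (phi_natural hg.chain).map (constantCoeff : F2[X] →+* F2)
      rwa [Matrix.map_mul, Matrix.map_mul] at this
    have cf := hf.chain.hat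
    have cg := hg.chain.hat
    have rC := C.hatRel
    have rC' := C'.hatRel
    have rD := D.hatRel
    have rD' := D'.hatRel
    have h1 : Homotopic C.dHat C'.dHat (C'.phi * C'.iota * hat f) (hat f * (C.phi * C.iota)) := by
      rw [Matrix.mul_assoc, ← Matrix.mul_assoc (hat f)]
      refine (Homotopic.mul_left rC'.chain_phi hf.comm).trans ?_
      rw [← Matrix.mul_assoc]
      exact Homotopic.mul_right rC.chain_iota pf
    have h2 : Homotopic D.dHat D'.dHat (D'.iota * D'.phi * hat g) (hat g * (D.iota * D.phi)) := by
      rw [Matrix.mul_assoc, ← Matrix.mul_assoc (hat g)]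
      refine (Homotopic.mul_left rD'.chain_iota pg).trans ?_
      rw [← Matrix.mul_assoc]
      exact Homotopic.mul_right rD.chain_phi hg.comm
    rw [BigradedComplex.tensor_dHat, BigradedComplex.tensor_dHat, hat_kronecker]
    change Homotopic _ _ ((C'.iota ⊗ₖ D'.iota + (C'.phi * C'.iota) ⊗ₖ (D'.iota * D'.phi)) *
        (hat f ⊗ₖ hat g))
      ((hat f ⊗ₖ hat g) * (C.iota ⊗ₖ D.iota + (C.phi * C.iota) ⊗ₖ (D.iota * D.phi)))
    rw [Matrix.add_mul, Matrix.mul_add]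
    simp only [← Matrix.mul_kronecker_mul]
    refine Homotopic.add ?_ ?_
    · exact (hf.comm.kronecker_left (rD'.chain_iota.mul cg)).trans
        (hg.comm.kronecker_right (cf.mul rC.chain_iota))
    · exact (h1.kronecker_left ((rD'.chain_iota.mul rD'.chain_phi).mul cg)).trans
        (h2.kronecker_right (cf.mul (rC.chain_phi.mul rC.chain_iota)))

/-- Comparison of complexes along a bijection of bases followed by a self-map. -/
theorem le_of_equiv {C D : HorizontalComplex} (e : C.gen ≃ D.gen)
    (hdeg : ∀ i, D.deg (e i) = C.deg i) (hd : D.d.submatrix e e = C.d)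
    (F : Matrix C.gen C.gen F2[X]) (hF : IsHomog C.deg C.deg 0 F) (hc : IsChainMap C.d C.d F)
    (hl : IsHomotopyEquiv C.dLoc C.dLoc (loc F))
    (hi : Homotopic C.dHat C.dHat (D.iota.submatrix e e * hat F) (hat F * C.iota)) : C ≤ D := by
  have hP := permMat_isHomotopyInverse e hd
  have hat' : D.dHat.submatrix e e = C.dHat := by
    rw [BigradedComplex.dHat, BigradedComplex.dHat, ← hd]; rfl
  have loc' : D.dLoc.submatrix e e = C.dLoc := by
    rw [BigradedComplex.dLoc, BigradedComplex.dLoc, ← hd]; rfl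
  refine ⟨permMat _ e * F, ?_, hP.chain_f.mul hc, ?_, ?_⟩
  · simpa using (permMat_homog e hdeg).mul hF
  · rw [loc_mul, loc_permMat]
    exact IsHomotopyEquiv.comp ⟨_, permMat_isHomotopyInverse e loc'⟩ hl
  · rw [hat_mul, hat_permMat, ← Matrix.mul_assoc, mul_permMat, Matrix.mul_assoc, Matrix.mul_assoc]
    exact Homotopic.mul_left (permMat_isHomotopyInverse e hat').chain_f hi

/-- Comparison of complexes along a bijection of bases. -/
theorem equiv_of_equiv {C D : HorizontalComplex} (e : C.gen ≃ D.gen)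
    (hdeg : ∀ i, D.deg (e i) = C.deg i) (hd : D.d.submatrix e e = C.d)
    (hi : Homotopic C.dHat C.dHat (D.iota.submatrix e e) C.iota) : C ≤ D := by
  have h1 := IsAlmostLocal.one C
  refine le_of_equiv e hdeg hd 1 h1.homog h1.chain h1.isLocal ?_
  rw [hat_one, Matrix.mul_one, Matrix.one_mul]
  exact hi

theorem tensorD_assoc {R I J K : Type*} [CommRing R] [Fintype I] [Fintype J] [Fintype K]
    [DecidableEq I] [DecidableEq J] [DecidableEq K] (a : Matrix I I R) (b : Matrix J J R)
    (c : Matrix K K R) :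
    (tensorD (tensorD a b) c).submatrix (Equiv.prodAssoc I J K).symm
      (Equiv.prodAssoc I J K).symm = tensorD a (tensorD b c) := by
  have hs : ∀ (A : Matrix I I R) (B : Matrix J J R) (C : Matrix K K R),
      ((A ⊗ₖ B) ⊗ₖ C).submatrix (Equiv.prodAssoc I J K).symm (Equiv.prodAssoc I J K).symm =
        A ⊗ₖ (B ⊗ₖ C) := fun A B C => Matrix.kronecker_assoc A B C
  have h1 : ((1 : Matrix (I × J) (I × J) R) ⊗ₖ c).submatrix (Equiv.prodAssoc I J K).symm
      (Equiv.prodAssoc I J K).symm = (1 : Matrix I I R) ⊗ₖ ((1 : Matrix J J R) ⊗ₖ c) := by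
    rw [← hs, Matrix.one_kronecker_one]
  simp only [tensorD, Matrix.add_kronecker, Matrix.submatrix_add, Pi.add_apply, hs, h1,
    Matrix.kronecker_add, Matrix.one_kronecker_one, add_assoc]

theorem tensor_assoc_ge (A B C : HorizontalComplex) :
    A.tensor (B.tensor C) ≤ (A.tensor B).tensor C := by
  refine equiv_of_equiv (Equiv.prodAssoc A.gen B.gen C.gen).symm ?_ (tensorD_assoc _ _ _) ?_
  · rintro ⟨a, b, c⟩
    exact add_assoc _ _ _
  · have := A.hatRel.assoc B.hatRel C.hatRel
    rw [BigradedComplex.tensor_dHat, BigradedComplex.tensor_dHat]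
    rw [← BigradedComplex.tensor_phi, ← BigradedComplex.tensor_phi] at this
    exact this

theorem tensorD_swap {R I J : Type*} [CommRing R] [Fintype I] [Fintype J]
    [DecidableEq I] [DecidableEq J] (a : Matrix I I R) (b : Matrix J J R) :
    (tensorD b a).submatrix (Equiv.prodComm I J) (Equiv.prodComm I J) = tensorD a b := by
  ext ⟨i, j⟩ ⟨i', j'⟩
  simp [tensorD, mul_comm, add_comm]

theorem tensor_comm_le (C D : HorizontalComplex) : C.tensor D ≤ D.tensor C := by
  obtain ⟨f, hf, hf', hf''⟩ := C.psi_lift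
  have hΦ := formalDeriv_chain D.d_sq
  have cF : IsChainMap (C.tensor D).d (C.tensor D).d (1 + f ⊗ₖ formalDeriv D.d) :=
    (IsChainMap.one _).add (hf'.kronecker hΦ)
  refine le_of_equiv (C := C.tensor D) (D := D.tensor C) (Equiv.prodComm C.gen D.gen) ?_
    (tensorD_swap _ _) (1 + f ⊗ₖ formalDeriv D.d) ?_ cF ?_ ?_
  · rintro ⟨a, b⟩
    exact add_comm _ _
  · refine IsHomog.one.add ?_
    exact hf.kronecker D.d_homog.formalDeriv
  · have h2 : Homotopic (C.tensor D).d (C.tensor D).d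
        ((1 + f ⊗ₖ formalDeriv D.d) * (1 + f ⊗ₖ formalDeriv D.d)) 1 := by
      have e1 : (1 + f ⊗ₖ formalDeriv D.d) * (1 + f ⊗ₖ formalDeriv D.d) =
          1 + (f * f) ⊗ₖ (formalDeriv D.d * formalDeriv D.d) := by
        rw [Matrix.mul_kronecker_mul, Matrix.mul_add, Matrix.mul_one, Matrix.add_mul,
          Matrix.one_mul, ← add_assoc, add_assoc (1 : Matrix (C.gen × D.gen) (C.gen × D.gen) F2[X]),
          add_self_zero, add_zero]
      rw [e1]
      have h3 := (formalDeriv_sq_homotopic D.d_sq).kronecker_right (hf'.mul hf')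
      have h4 := (Homotopic.refl (dC := (C.tensor D).d) (dD := (C.tensor D).d) 1).add h3
      simpa using h4
    have h3 := h2.map (toLaurent : F2[X] →+* F2[T;T⁻¹])
    rw [Matrix.map_mul, Matrix.map_one _ (map_zero _) (map_one _)] at h3
    exact ⟨_, cF.map _, cF.map _, h3, h3⟩
  · have hF : Homotopic (tensorD C.dHat D.dHat) (tensorD C.dHat D.dHat)
        (hat (1 + f ⊗ₖ formalDeriv D.d)) (1 + (C.iota * C.phi * C.iota) ⊗ₖ D.phi) := by
      rw [hat_add, hat_one, hat_kronecker]
      exact (Homotopic.refl 1).add (hf''.kronecker_left D.phi_chain)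
    have hs : (tensorIota D.phi D.iota C.phi C.iota).submatrix (Equiv.prodComm C.gen D.gen)
        (Equiv.prodComm C.gen D.gen) =
        C.iota ⊗ₖ D.iota + (C.iota * C.phi) ⊗ₖ (D.phi * D.iota) := by
      ext ⟨i, j⟩ ⟨i', j'⟩
      simp [tensorIota, mul_comm]
    change Homotopic (C.tensor D).dHat (C.tensor D).dHat
      ((tensorIota D.phi D.iota C.phi C.iota).submatrix (Equiv.prodComm C.gen D.gen)
        (Equiv.prodComm C.gen D.gen) * _) (_ * tensorIota C.phi C.iota D.phi D.iota)
    rw [hs, BigradedComplex.tensor_dHat]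
    have rC := C.hatRel
    have rD := D.hatRel
    refine (Homotopic.mul_left ?_ hF).trans ((rC.comm rD).trans
      (Homotopic.mul_right (rC.tensor rD).chain_iota hF).symm)
    exact (rC.chain_iota.kronecker rD.chain_iota).add
      ((rC.chain_iota.mul rC.chain_phi).kronecker (rD.chain_phi.mul rD.chain_iota))

theorem tensor_assoc_le (A B C : HorizontalComplex) :
    (A.tensor B).tensor C ≤ A.tensor (B.tensor C) :=
  calc (A.tensor B).tensor C
      ≤ C.tensor (A.tensor B) := tensor_comm_le _ _
    _ ≤ (C.tensor A).tensor B := tensor_assoc_ge _ _ _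
    _ ≤ B.tensor (C.tensor A) := tensor_comm_le _ _
    _ ≤ (B.tensor C).tensor A := tensor_assoc_ge _ _ _
    _ ≤ A.tensor (B.tensor C) := tensor_comm_le _ _

theorem tensor_trivial_le (C : HorizontalComplex) :
    C.tensor trivial ≤ C := by
  refine equiv_of_equiv (C := C.tensor trivial) (Equiv.prodUnique C.gen Unit) ?_ ?_ ?_
  · rintro ⟨a, b⟩
    exact (add_zero _).symm
  · ext1 ⟨a, b⟩ ⟨c, e⟩
    simp [tensorD]
  · refine Homotopic.of_eq ?_
    change _ = tensorIota C.phi C.iota trivialComplex.phi 1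
    rw [trivial_phi]
    ext1 ⟨a, b⟩ ⟨c, e⟩
    simp [tensorIota]

theorem le_tensor_trivial (C : HorizontalComplex) :
    C ≤ C.tensor trivial := by
  refine equiv_of_equiv (D := C.tensor trivial) (Equiv.prodUnique C.gen Unit).symm ?_ ?_ ?_
  · intro a
    exact add_zero _
  · ext1 a c
    simp [tensorD]
  · refine Homotopic.of_eq ?_
    change (tensorIota C.phi C.iota trivialComplex.phi 1).submatrix _ _ = _
    rw [trivial_phi]
    ext1 a c
    simp [tensorIota]

section Trace

variable {R I J K L : Type*} [CommRing R] [Fintype I] [DecidableEq I] [Fintype J] [Fintype K]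
  [Fintype L]

/-- The linear functional on `R^I ⊗ R^J` with coefficient matrix `M`. -/
def rowOf (M : Matrix I J R) : Matrix Unit (I × J) R := Matrix.of fun _ x => M x.1 x.2

theorem rowOf_mul (M : Matrix I J R) (A : Matrix I K R) (B : Matrix J L R) :
    rowOf M * (A ⊗ₖ B) = rowOf (Aᵀ * M * B) := by
  ext1 u ⟨i, j⟩
  simp only [rowOf, Matrix.mul_apply, Matrix.of_apply, Fintype.sum_prod_type,
    Matrix.kronecker_apply, Matrix.transpose_apply, Finset.sum_mul]
  rw [Finset.sum_comm]
  refine Finset.sum_congr rfl fun _ _ => Finset.sum_congr rfl fun _ _ => by ring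

theorem rowOf_add (M N : Matrix I J R) : rowOf (M + N) = rowOf M + rowOf N := rfl

/-- The trace `R^I ⊗ (R^I)* → R`. -/
def traceRow (R I : Type*) [CommRing R] [DecidableEq I] : Matrix Unit (I × I) R :=
  rowOf (1 : Matrix I I R)

theorem traceRow_mul (A : Matrix I K R) (B : Matrix I L R) :
    traceRow R I * (A ⊗ₖ B) = rowOf (Aᵀ * B) := by
  rw [traceRow, rowOf_mul, Matrix.mul_one]

theorem traceRow_chain [CharP R 2] (d : Matrix I I R) : traceRow R I * tensorD d dᵀ = 0 := by
  rw [tensorD, Matrix.mul_add, traceRow_mul, traceRow_mul]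
  simpa using add_self_zero (rowOf dᵀ)

theorem tensorD_transpose [DecidableEq J] (d : Matrix I I R) (d' : Matrix J J R) :
    (tensorD d d')ᵀ = tensorD dᵀ d'ᵀ := by
  ext1 ⟨i, j⟩ ⟨i', j'⟩
  simp [tensorD, Matrix.one_apply, eq_comm]

end Trace

theorem hat_traceRow {I : Type*} [DecidableEq I] : hat (traceRow F2[X] I) = traceRow F2 I := by
  ext1 u ⟨i, j⟩
  by_cases h : i = j <;> simp [hat, traceRow, rowOf, Matrix.one_apply, h]

theorem loc_traceRow {I : Type*} [DecidableEq I] :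
    loc (traceRow F2[X] I) = traceRow F2[T;T⁻¹] I := by
  ext1 u ⟨i, j⟩
  by_cases h : i = j <;> simp [loc, traceRow, rowOf, Matrix.one_apply, h]

theorem traceRow_homog {I : Type*} [DecidableEq I] (deg : I → ℤ × ℤ) :
    IsHomog (fun x : I × I => deg x.1 + -deg x.2) (fun _ : Unit => 0) 0 (traceRow F2[X] I) := by
  rintro u ⟨i, j⟩ k h
  have h1 : i = j := by
    by_contra hij
    exact h (by simp [traceRow, rowOf, Matrix.one_apply_ne hij])
  subst h1
  have := IsHomog.one (dI := deg) i i k h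
  simpa using this

theorem traceRow_homog' {I : Type*} [DecidableEq I] (deg : I → ℤ × ℤ) :
    IsHomog (fun _ : Unit => 0) (fun x : I × I => deg x.1 + -deg x.2) 0 (traceRow F2[X] I)ᵀ := by
  rintro ⟨i, j⟩ u k h
  have h1 : i = j := by
    by_contra hij
    exact h (by simp [traceRow, rowOf, Matrix.one_apply_ne hij])
  subst h1
  have := IsHomog.one (dI := deg) i i k h
  simpa using this

theorem iota_sq_add (C : HorizontalComplex) : ∃ h : Matrix C.gen C.gen F2,
    C.iota * C.iota + C.phi * C.iota * (C.phi * C.iota) = 1 + (C.dHat * h + h * C.dHat) := by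
  obtain ⟨h, hh⟩ := C.iota_sq
  refine ⟨h, ?_⟩
  rw [hh, ← Matrix.mul_assoc (C.phi * C.iota)]
  apply eq_of_add_zero
  have a1 := add_self_zero (1 + (C.dHat * h + h * C.dHat))
  have a2 := add_self_zero (C.phi * C.iota * C.phi * C.iota)
  calc _ = ((1 : Matrix C.gen C.gen F2) + (C.dHat * h + h * C.dHat) +
        (1 + (C.dHat * h + h * C.dHat))) +
        (C.phi * C.iota * C.phi * C.iota + C.phi * C.iota * C.phi * C.iota) := by abel
    _ = 0 := by rw [a1, a2, add_zero]

/-- The relation `ι² + ΦιΦι ∼ 1` read through the trace. -/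
theorem trace_iota (C : HorizontalComplex) : Homotopic (tensorD C.dHat C.dHatᵀ)
    (0 : Matrix Unit Unit F2) (traceRow F2 C.gen * tensorIota C.phi C.iota C.phiᵀ C.iotaᵀ)
    (traceRow F2 C.gen) := by
  obtain ⟨h, hh⟩ := C.iota_sq_add
  refine ⟨rowOf hᵀ, ?_⟩
  rw [tensorIota, Matrix.mul_add, traceRow_mul, traceRow_mul, tensorD, Matrix.mul_add, rowOf_mul,
    rowOf_mul, Matrix.zero_mul, zero_add]
  simp only [Matrix.mul_one, Matrix.transpose_one, Matrix.one_mul, ← Matrix.transpose_mul,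
    ← rowOf_add, ← Matrix.transpose_add]
  rw [hh, Matrix.transpose_add, rowOf_add, Matrix.transpose_one, traceRow,
    add_comm (C.dHat * h)]

theorem cotrace_iota (C : HorizontalComplex) : Homotopic (tensorD C.dHatᵀ C.dHat)
    (0 : Matrix Unit Unit F2) (traceRow F2 C.gen * (tensorIota C.phi C.iota C.phiᵀ C.iotaᵀ)ᵀ)
    (traceRow F2 C.gen) := by
  obtain ⟨h, hh⟩ := C.iota_sq_add
  refine ⟨rowOf h, ?_⟩
  have h1 : (tensorIota C.phi C.iota C.phiᵀ C.iotaᵀ)ᵀ =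
      C.iotaᵀ ⊗ₖ C.iota + (C.phi * C.iota)ᵀ ⊗ₖ (C.phi * C.iota) := by
    rw [tensorIota, ← Matrix.transpose_mul]
    rfl
  rw [h1, Matrix.mul_add, traceRow_mul, traceRow_mul, tensorD, Matrix.mul_add, rowOf_mul,
    rowOf_mul, Matrix.zero_mul, zero_add]
  simp only [Matrix.mul_one, Matrix.transpose_one, Matrix.one_mul, Matrix.transpose_transpose,
    ← rowOf_add]
  rw [hh, rowOf_add, traceRow]

theorem trace_local (C : HorizontalComplex) : IsHomotopyEquiv (tensorD C.dLoc C.dLocᵀ)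
    (0 : Matrix Unit Unit F2[T;T⁻¹]) (traceRow F2[T;T⁻¹] C.gen) := by
  obtain ⟨f, g, -, -, hfg⟩ := C.localization
  have hfg' := hfg.transpose
  have hpair := hfg.symm.kronecker hfg'
  have hone : f * g = 1 := by
    obtain ⟨h, hh⟩ := hfg.right
    simpa using hh
  refine IsHomotopyEquiv.of_comp_right ?_ ⟨_, hpair⟩ ?_
  · rw [IsChainMap, traceRow_chain, Matrix.zero_mul]
  · have h1 : traceRow F2[T;T⁻¹] C.gen * (g ⊗ₖ fᵀ) =
        permMat F2[T;T⁻¹] (Equiv.punitProd Unit : Unit × Unit ≃ Unit) := by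
      rw [traceRow_mul, ← Matrix.transpose_mul, hone]
      ext1 u ⟨i, j⟩
      simp [rowOf, permMat, Matrix.one_apply]
    rw [h1]
    exact ⟨_, permMat_isHomotopyInverse _ (by simp [tensorD])⟩

theorem tensor_dual_le (C : HorizontalComplex) : C.tensor C.dual ≤ trivial := by
  refine ⟨traceRow F2[X] C.gen, traceRow_homog C.deg, ?_, ?_, ?_⟩
  · change (0 : Matrix Unit Unit F2[X]) * _ = traceRow F2[X] C.gen * tensorD C.d C.dᵀ
    rw [traceRow_chain, Matrix.zero_mul]
  · rw [BigradedComplex.tensor_dLoc, trivial_dLoc]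
    erw [loc_traceRow]
    exact C.trace_local
  · rw [BigradedComplex.tensor_dHat, trivial_dHat]
    erw [hat_traceRow, Matrix.one_mul]
    exact C.trace_iota.symm

theorem le_tensor_dual (C : HorizontalComplex) : trivial ≤ C.tensor C.dual := by
  refine ⟨(traceRow F2[X] C.gen)ᵀ, traceRow_homog' C.deg, ?_, ?_, ?_⟩
  · change tensorD C.d C.dᵀ * (traceRow F2[X] C.gen)ᵀ = _ * (0 : Matrix Unit Unit F2[X])
    have := congrArg Matrix.transpose (traceRow_chain C.dᵀ)
    rw [Matrix.transpose_mul, tensorD_transpose, Matrix.transpose_transpose] at this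
    rw [this, Matrix.mul_zero, Matrix.transpose_zero]
  · rw [BigradedComplex.tensor_dLoc, trivial_dLoc]
    rw [loc_transpose]
    erw [loc_traceRow]
    obtain ⟨g, hg⟩ := C.dual.trace_local
    have := hg.transpose
    rw [tensorD_transpose, Matrix.transpose_zero] at this
    exact ⟨_, this⟩
  · rw [BigradedComplex.tensor_dHat, trivial_dHat, hat_transpose]
    erw [hat_traceRow, Matrix.mul_one]
    have := C.cotrace_iota.transpose
    rw [tensorD_transpose, Matrix.transpose_zero, Matrix.transpose_mul,
      Matrix.transpose_transpose, Matrix.transpose_transpose] at this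
    exact this

/-- Dualizing reverses the order. -/
theorem dual_anti {C D : HorizontalComplex} (h : C ≤ D) : D.dual ≤ C.dual :=
  calc D.dual ≤ D.dual.tensor trivial := le_tensor_trivial _
    _ ≤ D.dual.tensor (C.tensor C.dual) := tensor_mono le_rfl (le_tensor_dual C)
    _ ≤ D.dual.tensor (D.tensor C.dual) := tensor_mono le_rfl (tensor_mono h le_rfl)
    _ ≤ (D.dual.tensor D).tensor C.dual := tensor_assoc_ge _ _ _
    _ ≤ C.dual.tensor (D.dual.tensor D) := tensor_comm_le _ _
    _ ≤ C.dual.tensor (D.tensor D.dual) := tensor_mono le_rfl (tensor_comm_le _ _)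
    _ ≤ C.dual.tensor trivial := tensor_mono le_rfl (tensor_dual_le D)
    _ ≤ C.dual := tensor_trivial_le _

end HorizontalComplex

open HorizontalComplex

/-- The set of almost `ι_K`-local equivalence classes of horizontal almost `ι_K`-complexes: two
complexes are equivalent if there are almost `ι_K`-local maps between them in both directions. -/
def LocalClass : Type 1 := Antisymmetrization HorizontalComplex (· ≤ ·)

namespace LocalClass

/-- The partial order on classes: `[C] ≤ [D]` if there is an almost `ι_K`-local map `C → D`. -/
instance : PartialOrder LocalClass :=
  inferInstanceAs (PartialOrder (Antisymmetrization HorizontalComplex (· ≤ ·)))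

/-- The class `[C]`. -/
def mk (C : HorizontalComplex) : LocalClass := toAntisymmetrization (· ≤ ·) C

/-- The group operation `[C] + [D] = [C ⊗ D]`. -/
instance : Add LocalClass where
  add := Quotient.map₂ HorizontalComplex.tensor
    fun _ _ h _ _ h' => ⟨tensor_mono h.1 h'.1, tensor_mono h.2 h'.2⟩

/-- The zero element is the class of the trivial complex. -/
instance : Zero LocalClass where
  zero := mk trivial

/-- The inverse is the class of the dual complex. -/
instance : Neg LocalClass where
  neg := Quotient.map HorizontalComplex.dual fun _ _ h => ⟨dual_anti h.2, dual_anti h.1⟩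

/-- The abelian group of classes under tensor product. -/
instance : AddCommGroup LocalClass where
  add_assoc a b c := by
    induction a, b, c using Quotient.inductionOn₃ with
    | _ A B C =>
      exact Quotient.sound ⟨tensor_assoc_le A B C, tensor_assoc_ge A B C⟩
  zero_add a := by
    induction a using Quotient.inductionOn with
    | _ A =>
      exact Quotient.sound ⟨(tensor_comm_le _ _).trans (tensor_trivial_le A),
        (le_tensor_trivial A).trans (tensor_comm_le _ _)⟩
  add_zero a := by
    induction a using Quotient.inductionOn with
    | _ A => exact Quotient.sound ⟨tensor_trivial_le A, le_tensor_trivial A⟩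
  add_comm a b := by
    induction a, b using Quotient.inductionOn₂ with
    | _ A B => exact Quotient.sound ⟨tensor_comm_le A B, tensor_comm_le B A⟩
  neg_add_cancel a := by
    induction a using Quotient.inductionOn with
    | _ A =>
      exact Quotient.sound ⟨(tensor_comm_le _ _).trans (tensor_dual_le A),
        (le_tensor_dual A).trans (tensor_comm_le _ _)⟩
  nsmul := nsmulRec
  zsmul := zsmulRec

theorem mk_le_mk {C D : HorizontalComplex} :
    mk C ≤ mk D ↔ ∃ f : Matrix D.gen C.gen F2[X], IsAlmostLocal C D f := Iff.rfl

theorem mk_add_mk (C D : HorizontalComplex) : mk C + mk D = mk (C.tensor D) := rfl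

/-- The class of the figure-eight complex. -/
def figEight : LocalClass := mk HorizontalComplex.figEight

/-- Two classes are incomparable if neither is below the other. -/
def Incomparable (x y : LocalClass) : Prop := ¬ x ≤ y ∧ ¬ y ≤ x

/-- The quotient group by the subgroup generated by the class of the figure-eight complex. -/
abbrev ModFigEight : Type 1 := LocalClass ⧸ AddSubgroup.zmultiples figEight

/-- The relation induced by `≤` on the quotient group: some representatives are related. -/
def ModFigEight.le (p q : ModFigEight) : Prop :=
  ∃ x y : LocalClass, (x : ModFigEight) = p ∧ (y : ModFigEight) = q ∧ x ≤ y

end LocalClass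

end

end HorizontalIota

/-! Tensor product is monotone, so the classes form an ordered abelian group, and everything reduces
to comparing a complex `C` with zero. The claim to prove is that `C` is comparable with `trivial`
unless `figEight ≤ C`.

Since the localization has rank one, `C` contains a homogeneous cycle `x` and a homogeneous cocycle
`p` with `p x = 1` (`exists_homog_split`), and the bidegree of `x` is a multiple of that of `U`. If
this multiple is nonzero, a positive power of `U` times `x` or `p` has bidegree zero and vanishes
modulo `U`. The condition on `ι` is then empty and `C` is comparable with `trivial`
(`comparable_or_exists_split`).

Otherwise the tower starts in bidegree zero, and a linear alternative over the field with two
elements decides (`le_trivial_or_figEight_le`). Consider the cycles `v` of `C/U` for which `(1 + ι)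
v` lifts to a cycle of `C`. If `p (1 + ι)` vanishes on all of them, duality of finite-dimensional
spaces corrects `p` to a cocycle that is `ι`-invariant up to homotopy, so `C ≤ trivial`. If not,
some `v` has `(1 + ι) v` equal to the reduction of a tower generator `w`. Then `a ↦ v`, `b ↦ ∂v/U`,
`c ↦ ιΦv`, `d ↦ ∂c/U`, `x ↦ w` (with constant lifts of `v` and of the image of `c`) is an almost
local map from the figure-eight complex (`figEight_le`); the relations between `Φ` and `ι` are
exactly what makes it commute with the involutions up to homotopy.

The figure-eight complex is self-dual and not below `trivial`, hence it is incomparable with zero.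
If a class is incomparable with zero, so is its negative; both then lie above the figure-eight
class, and self-duality gives equality (`incomparable_zero_iff`). Translation yields the general
criterion. Self-duality also gives order two, and in the quotient the only incomparable pairs have
been identified, which makes the order total. -/

namespace HorizontalIota

open Polynomial LaurentPolynomial Matrix
open scoped Kronecker

noncomputable section

/-! ### Splittings over a principal ideal domain and clearing denominators -/

section Splitting

/-- Over a principal ideal domain the kernel of a matrix is a direct summand: `1 - σ` is a
projection onto it. -/
theorem exists_ker_complement {R I J : Type*} [CommRing R] [IsDomain R] [IsPrincipalIdealRing R]
    [Fintype I] [DecidableEq I] [Fintype J] (d : Matrix J I R) :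
    ∃ σ : Matrix I I R, d * σ = d ∧
      ∀ {K : Type} (w : Matrix I K R), d * w = 0 → σ * w = 0 := by
  -- The image of `d` lies in a free module over a PID, so it is projective and `d` has a section
  -- `s` over it. The map `σ` is `d` followed by `s`.
  obtain ⟨s, hs⟩ := Module.projective_lifting_property d.mulVecLin.rangeRestrict LinearMap.id
    d.mulVecLin.surjective_rangeRestrict
  set σ : (I → R) →ₗ[R] (I → R) := s ∘ₗ d.mulVecLin.rangeRestrict with hσ
  have h1 : ∀ v, d *ᵥ σ v = d *ᵥ v := fun v => by
    have := congrArg Subtype.val (LinearMap.congr_fun hs (d.mulVecLin.rangeRestrict v))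
    simpa [hσ] using this
  have h2 : ∀ v, d *ᵥ v = 0 → σ v = 0 := fun v hv => by
    have : d.mulVecLin.rangeRestrict v = 0 := Subtype.ext (by simpa using hv)
    rw [hσ, LinearMap.comp_apply, this, map_zero]
  have h3 : ∀ v, LinearMap.toMatrix' σ *ᵥ v = σ v := fun v => by
    rw [← Matrix.toLin'_apply, Matrix.toLin'_toMatrix']
  refine ⟨LinearMap.toMatrix' σ, ?_, fun w hw => ?_⟩
  · refine Matrix.ext_of_mulVec_single fun i => ?_
    rw [← Matrix.mulVec_mulVec, h3, h1]
  · ext i k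
    have hk : d *ᵥ w.col k = 0 := by
      ext j
      exact congrFun (congrFun hw j) k
    exact congrFun ((h3 _).trans (h2 _ hk)) i

/-- A functional `f` that vanishes on boundaries but not on all cycles can be divided by a scalar
so that it becomes surjective on cycles. -/
theorem exists_split_functional {R I : Type*} [CommRing R] [IsDomain R] [IsPrincipalIdealRing R]
    [Fintype I] [DecidableEq I] {d : Matrix I I R} (hd : d * d = 0) {f : Matrix Unit I R}
    {g : Matrix I Unit R} (hf : f * d = 0) (hg : d * g = 0) (hfg : f * g ≠ 0) :
    ∃ (p : Matrix Unit I R) (x : Matrix I Unit R), p * d = 0 ∧ d * x = 0 ∧ p * x = 1 := by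
  obtain ⟨σ, h1, h2⟩ := exists_ker_complement d
  let φ : (I → R) →ₗ[R] R := (LinearMap.proj ()) ∘ₗ f.mulVecLin
  have hφ : ∀ v, φ v = (f *ᵥ v) () := fun v => rfl
  let S : Ideal R := (LinearMap.ker d.mulVecLin).map φ
  -- The values of `f` on cycles form an ideal. Its generator `r` is the scalar to divide by, and
  -- `x` is a cycle where `f` takes the value `r`.
  obtain ⟨r, hr⟩ := (IsPrincipalIdealRing.principal S).principal
  obtain ⟨x, hx, hxr⟩ : r ∈ S := hr ▸ Submodule.mem_span_singleton_self r
  have hdvd : ∀ v, d *ᵥ v = 0 → r ∣ (f *ᵥ v) () := fun v hv => by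
    have : φ v ∈ S := ⟨v, by simpa using hv, rfl⟩
    rw [hr] at this
    exact Ideal.mem_span_singleton.1 this
  have hr0 : r ≠ 0 := by
    rintro rfl
    apply hfg
    have := hdvd (g.col ()) (by ext j; exact congrFun (congrFun hg j) ())
    ext ⟨⟩ ⟨⟩
    exact zero_dvd_iff.1 this
  have hπ : d * (1 - σ) = 0 := by rw [Matrix.mul_sub, Matrix.mul_one, h1, sub_self]
  -- The functional `f` itself need not be divisible by `r`, but its composite with the projection
  -- onto cycles is. On cycles the two agree, and both vanish on boundaries.
  choose p hp using fun i => hdvd ((1 - σ).col i) (by ext j; exact congrFun (congrFun hπ j) i)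
  have hp' : f * (1 - σ) = r • Matrix.of fun _ : Unit => p := by
    ext ⟨⟩ i
    exact hp i
  have hx' : d * Matrix.of (fun i (_ : Unit) => x i) = 0 := by
    ext i ⟨⟩
    exact congrFun hx i
  refine ⟨Matrix.of fun _ => p, Matrix.of fun i _ => x i, smul_right_injective _ hr0 ?_, hx',
    smul_right_injective _ hr0 ?_⟩
  all_goals dsimp only
  · have hσd : σ * d = 0 := by
      ext i j
      have h := h2 (Matrix.of fun i (_ : Unit) => d i j) (by
        ext k ⟨⟩
        exact congrFun (congrFun hd k) j)
      exact congrFun (congrFun h i) ()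
    rw [← Matrix.smul_mul, ← hp', Matrix.mul_assoc, Matrix.sub_mul, hσd, Matrix.one_mul, sub_zero,
      hf, smul_zero]
  · rw [← Matrix.smul_mul, ← hp', Matrix.mul_assoc, Matrix.sub_mul, h2 _ hx', Matrix.one_mul,
      sub_zero]
    ext ⟨⟩ ⟨⟩
    simpa [hφ, Matrix.mul_apply, Matrix.mulVec, dotProduct] using hxr

theorem loc_injective {I J : Type*} : Function.Injective (loc : Matrix J I F2[X] → _) :=
  Matrix.map_injective toLaurent_injective

theorem loc_zero {I J : Type*} : loc (0 : Matrix J I F2[X]) = 0 := by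
  ext1
  simp [loc]

/-- Finitely many Laurent polynomials have a common denominator, a power of `U`, which is a unit
after localization. -/
theorem exists_loc_eq_smul {I J : Type*} [Finite I] [Finite J] (f : Matrix J I F2[T;T⁻¹]) :
    ∃ (b : F2[T;T⁻¹]) (f' : Matrix J I F2[X]), IsUnit b ∧ loc f' = b • f := by
  obtain ⟨b, hb⟩ := IsLocalization.exist_integer_multiples_of_finite
    (Submonoid.powers (X : F2[X])) fun x : J × I => f x.1 x.2
  choose f' hf' using hb
  refine ⟨algebraMap _ _ (b : F2[X]), Matrix.of fun j i => f' (j, i),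
    IsLocalization.map_units _ b, ?_⟩
  ext1 j i
  exact (hf' (j, i)).trans (Algebra.smul_def _ _)

end Splitting

/-! ### Consequences of the rank-one localization -/

theorem Homotopic.eq_of_zero {R I J : Type*} [CommRing R] [Fintype I] [Fintype J]
    {f g : Matrix J I R} (h : Homotopic 0 0 f g) : f = g := by
  obtain ⟨h, rfl⟩ := h
  simp

theorem isHomotopyEquiv_of_inverse {R I : Type*} [CommRing R] [Fintype I] [DecidableEq I]
    {M N : Matrix I I R} (h : M * N = 1) : IsHomotopyEquiv 0 0 M :=
  ⟨N, by simp [IsChainMap], by simp [IsChainMap], Homotopic.of_eq (mul_eq_one_comm.1 h),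
    Homotopic.of_eq h⟩

namespace HorizontalComplex

/-- The localization of a horizontal complex has rank one homology, so that a cycle and a cocycle
which pair to one are homotopy equivalences. -/
theorem isHomotopyEquiv_of_mul_eq_one (C : HorizontalComplex) {r : Matrix Unit C.gen F2[T;T⁻¹]}
    {q : Matrix C.gen Unit F2[T;T⁻¹]} (hr : r * C.dLoc = 0) (hq : C.dLoc * q = 0)
    (h : r * q = 1) : IsHomotopyEquiv 0 C.dLoc q ∧ IsHomotopyEquiv C.dLoc 0 r := by
  have cr : IsChainMap C.dLoc (0 : Matrix Unit Unit F2[T;T⁻¹]) r := by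
    rw [IsChainMap, hr, Matrix.zero_mul]
  have cq : IsChainMap (0 : Matrix Unit Unit F2[T;T⁻¹]) C.dLoc q := by
    rw [IsChainMap, hq, Matrix.mul_zero]
  obtain ⟨f, g, -, -, hfg⟩ := C.localization
  -- Inserting `g f ∼ 1` between `r` and `q` changes nothing, as homotopic maps between complexes
  -- with zero differential are equal. Hence `f q` is invertible, and two-out-of-three gives the
  -- claim for `q`, then for `r`.
  have h1 : r * g * (f * q) = 1 := by
    have := (Homotopic.mul_left cr (Homotopic.mul_right cq hfg.left)).eq_of_zero
    rw [Matrix.one_mul, h] at this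
    simpa only [Matrix.mul_assoc] using this
  have e1 := IsHomotopyEquiv.of_comp_left cq ⟨g, hfg⟩
    (isHomotopyEquiv_of_inverse (mul_eq_one_comm.1 h1))
  refine ⟨e1, IsHomotopyEquiv.of_comp_right cr e1 ?_⟩
  rw [h]
  exact isHomotopyEquiv_of_inverse (Matrix.one_mul 1)

/-- The maps that identify the localization with the Laurent polynomials become polynomial after
scaling by powers of `U`. They then pair to a nonzero element, and dividing out the generator of the
values on cycles makes a pairing equal to one. -/
theorem exists_split (C : HorizontalComplex) :
    ∃ (p : Matrix Unit C.gen F2[X]) (x : Matrix C.gen Unit F2[X]),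
      p * C.d = 0 ∧ C.d * x = 0 ∧ p * x = 1 := by
  obtain ⟨f, g, -, -, hfg⟩ := C.localization
  obtain ⟨b, f', hb, hf'⟩ := exists_loc_eq_smul f
  obtain ⟨c, g', hc, hg'⟩ := exists_loc_eq_smul g
  have hone : f * g = 1 := hfg.right.eq_of_zero
  have hfd : f * loc C.d = 0 := hfg.chain_f.symm.trans (Matrix.zero_mul _)
  have hdg : loc C.d * g = 0 := hfg.chain_g.trans (Matrix.mul_zero _)
  refine exists_split_functional C.d_sq (f := f') (g := g') ?_ ?_ ?_
  · apply loc_injective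
    rw [loc_mul, hf', Matrix.smul_mul, hfd, smul_zero, loc_zero]
  · apply loc_injective
    rw [loc_mul, hg', Matrix.mul_smul, hdg, smul_zero, loc_zero]
  · intro h
    have := congrArg loc h
    rw [loc_mul, hf', hg', Matrix.smul_mul, Matrix.mul_smul, hone, loc_zero] at this
    have := congrFun (congrFun this ()) ()
    simp only [Matrix.smul_apply, Matrix.one_apply_eq, Matrix.zero_apply, smul_eq_mul,
      mul_one] at this
    exact (hb.mul hc).ne_zero this

end HorizontalComplex

/-! ### Homogeneous parts and projections to a bidegree -/

section HomogPart

variable {I J K : Type*} (dI : I → ℤ × ℤ) (dJ : J → ℤ × ℤ) (s : ℤ × ℤ)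

/-- The homogeneous part of bidegree `s` of a map. -/
def homogPart (f : Matrix J I F2[X]) : Matrix J I F2[X] := Matrix.of fun j i =>
  ∑ k ∈ (f j i).support with dJ j + k • degU = dI i + s, monomial k ((f j i).coeff k)

variable {dI dJ s}

theorem coeff_homogPart (f : Matrix J I F2[X]) (j : J) (i : I) (k : ℕ) :
    (homogPart dI dJ s f j i).coeff k =
      if dJ j + k • degU = dI i + s then (f j i).coeff k else 0 := by
  simp only [homogPart, Matrix.of_apply, finsetSum_coeff, coeff_monomial,
    Finset.sum_ite_eq', Finset.mem_filter, mem_support_iff]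
  by_cases h : (f j i).coeff k = 0 <;> simp [h]

theorem homogPart_isHomog (f : Matrix J I F2[X]) : IsHomog dI dJ s (homogPart dI dJ s f) := by
  intro j i k h
  rw [coeff_homogPart] at h
  by_contra h'
  exact h (if_neg h')

theorem homogPart_zero : homogPart dI dJ s 0 = 0 := by
  ext j i k
  simp [coeff_homogPart]

theorem IsHomog.homogPart_eq {f : Matrix J I F2[X]} (hf : IsHomog dI dJ s f) :
    homogPart dI dJ s f = f := by
  ext j i k
  rw [coeff_homogPart, ite_eq_left_iff]
  intro h
  by_contra h'
  exact h (hf j i k (Ne.symm h'))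

/-- A homogeneous `g` shifts every bidegree by the same `t`, so only the part of `f` of bidegree `s`
contributes. With `g` the differential, homogeneous parts of cycles are cycles. -/
theorem IsHomog.homogPart_mul [Fintype J] {dK : K → ℤ × ℤ} {t : ℤ × ℤ} {g : Matrix K J F2[X]}
    (hg : IsHomog dJ dK t g) (f : Matrix J I F2[X]) :
    homogPart dI dK (s + t) (g * f) = g * homogPart dI dJ s f := by
  ext l i k
  simp only [coeff_homogPart, Matrix.mul_apply, finsetSum_coeff, coeff_mul]
  split_ifs with h
  · refine Finset.sum_congr rfl fun j _ => Finset.sum_congr rfl fun ab hab => ?_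
    by_cases h0 : (g l j).coeff ab.1 = 0
    · rw [h0, zero_mul, zero_mul]
    · rw [if_pos]
      have h1 := hg l j _ h0
      rw [← Finset.HasAntidiagonal.mem_antidiagonal.1 hab, add_smul, ← add_assoc, h1] at h
      rw [← add_left_inj t]
      rw [← add_assoc] at h
      rw [← h]
      abel
  · symm
    refine Finset.sum_eq_zero fun j _ => Finset.sum_eq_zero fun ab hab => ?_
    by_cases h0 : (g l j).coeff ab.1 = 0
    · rw [h0, zero_mul]
    · rw [if_neg, mul_zero]
      intro h2
      apply h
      rw [← Finset.HasAntidiagonal.mem_antidiagonal.1 hab, add_smul, ← add_assoc, hg l j _ h0,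
        ← add_assoc, ← h2]
      abel

theorem homogPart_transpose (f : Matrix J I F2[X]) :
    (homogPart dI dJ s f)ᵀ = homogPart (fun j => -dJ j) (fun i => -dI i) s fᵀ := by
  ext i j k
  rw [Matrix.transpose_apply, coeff_homogPart, coeff_homogPart, Matrix.transpose_apply]
  refine if_congr ?_ rfl rfl
  constructor <;> intro h <;> rw [← sub_eq_zero] at h ⊢ <;> rw [← h] <;> abel

/-- Transposition negates the bidegrees of the bases and keeps the shift of a map, so this is dual
to `IsHomog.homogPart_mul`. It handles cocycles. -/
theorem IsHomog.mul_homogPart [Fintype J] {dK : K → ℤ × ℤ} {t : ℤ × ℤ} {f : Matrix J I F2[X]}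
    (hf : IsHomog dI dJ t f) (g : Matrix K J F2[X]) :
    homogPart dI dK (t + s) (g * f) = homogPart dJ dK s g * f := by
  apply Matrix.transpose_injective
  rw [homogPart_transpose, Matrix.transpose_mul, Matrix.transpose_mul, homogPart_transpose, add_comm]
  exact hf.transpose.homogPart_mul _

end HomogPart

theorem hat_homogPart_apply {I J : Type*} {dI : I → ℤ × ℤ} {dJ : J → ℤ × ℤ} {s : ℤ × ℤ}
    (f : Matrix J I F2[X]) (j : J) (i : I) :
    hat (homogPart dI dJ s f) j i = if dJ j = dI i + s then hat f j i else 0 := by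
  have := coeff_homogPart (dI := dI) (dJ := dJ) (s := s) f j i 0
  rwa [zero_smul, add_zero] at this

section DegreeProj

variable {I J K : Type*} [Fintype I] [DecidableEq I]

/-- The projection of a graded vector space onto its part of bidegree `s`. -/
def degProj (deg : I → ℤ × ℤ) (s : ℤ × ℤ) : Matrix I I F2 :=
  Matrix.diagonal fun i => if deg i = s then 1 else 0

theorem degProj_mul_apply (deg : I → ℤ × ℤ) (s : ℤ × ℤ) (M : Matrix I K F2) (i : I) (k : K) :
    (degProj deg s * M) i k = if deg i = s then M i k else 0 := by
  rw [degProj, Matrix.diagonal_mul, ite_mul, one_mul, zero_mul]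

theorem mul_degProj_apply (deg : I → ℤ × ℤ) (s : ℤ × ℤ) (M : Matrix K I F2) (k : K) (i : I) :
    (M * degProj deg s) k i = if deg i = s then M k i else 0 := by
  rw [degProj, Matrix.mul_diagonal, mul_ite, mul_one, mul_zero]

/-- Only the matching of part `s` with part `t` is required, not homogeneity, so that the
skew-graded `ι` is covered as well as the differential. -/
theorem mul_degProj_eq [Fintype J] [DecidableEq J] {dI : I → ℤ × ℤ} {dJ : J → ℤ × ℤ}
    {s t : ℤ × ℤ} {M : Matrix J I F2} (h : ∀ j i, M j i ≠ 0 → (dI i = s ↔ dJ j = t)) :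
    M * degProj dI s = degProj dJ t * M := by
  ext j i
  rw [mul_degProj_apply, degProj_mul_apply]
  by_cases h0 : M j i = 0
  · simp [h0]
  · exact if_congr (h j i h0) rfl rfl

theorem hat_homogPart_column {dI : I → ℤ × ℤ} (x : Matrix I Unit F2[X]) (s : ℤ × ℤ) :
    hat (homogPart (fun _ : Unit => 0) dI s x) = degProj dI s * hat x := by
  ext i u
  rw [hat_homogPart_apply, degProj_mul_apply, zero_add]

theorem hat_homogPart_row {dI : I → ℤ × ℤ} (p : Matrix Unit I F2[X]) (s : ℤ × ℤ) :
    hat (homogPart dI (fun _ : Unit => 0) (-s) p) = hat p * degProj dI s := by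
  ext u i
  rw [hat_homogPart_apply, mul_degProj_apply]
  exact if_congr (by rw [eq_comm, add_neg_eq_zero]) rfl rfl

theorem degProj_sq (deg : I → ℤ × ℤ) (s : ℤ × ℤ) :
    degProj deg s * degProj deg s = degProj deg s := by
  ext i j
  rw [degProj_mul_apply, degProj, Matrix.diagonal_apply]
  split_ifs <;> rfl

/-- The projections to the occurring bidegrees sum to the identity. A nonzero pairing is therefore
nonzero in some single bidegree. -/
theorem sum_row_degProj_column (p : Matrix Unit I F2) (x : Matrix I Unit F2)
    (deg : I → ℤ × ℤ) :
    ∑ s ∈ Finset.univ.image deg, p * degProj deg s * x = p * x := by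
  rw [← Matrix.sum_mul, ← Matrix.mul_sum]
  have h1 : ∑ s ∈ Finset.univ.image deg, degProj deg s = 1 := by
    ext i j
    rw [Matrix.sum_apply]
    by_cases hij : i = j
    · subst hij
      simp [degProj]
    · simp [degProj, hij]
  rw [h1, Matrix.mul_one]

end DegreeProj

section Degree

theorem nsmul_degU_eq_zero {k : ℕ} (h : k • degU = 0) : k = 0 := by
  have := congrArg Prod.fst h
  simpa [degU] using this

/-- A degree-preserving endomorphism of `𝔽₂[U]` is a scalar. -/
theorem IsHomog.eq_one_of_hat {M : Matrix Unit Unit F2[X]}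
    (hM : IsHomog (fun _ => 0) (fun _ => 0) 0 M) (h : HorizontalIota.hat M = 1) : M = 1 := by
  ext ⟨⟩ ⟨⟩ k
  by_cases hk : k = 0
  · subst hk
    have := congrFun (congrFun h ()) ()
    simpa [HorizontalIota.hat] using this
  · rw [Matrix.one_apply_eq, coeff_one, if_neg hk]
    by_contra h0
    have := hM () () k h0
    rw [zero_add, zero_add] at this
    exact hk (nsmul_degU_eq_zero this)

theorem eq_one_of_ne_zero {M : Matrix Unit Unit F2} (h : M ≠ 0) : M = 1 := by
  ext ⟨⟩ ⟨⟩
  refine (Fin.eq_one_of_ne_zero _ fun h0 => h ?_ : _ = (1 : Fin 2))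
  ext ⟨⟩ ⟨⟩
  exact h0

theorem IsHomog.X_pow_smul {I J : Type*} {dI : I → ℤ × ℤ} {dJ : J → ℤ × ℤ} {s : ℤ × ℤ}
    {f : Matrix J I F2[X]} (hf : IsHomog dI dJ s f) (n : ℕ) :
    IsHomog dI dJ (s + n • degU) ((X ^ n : F2[X]) • f) := by
  intro j i k h
  rw [Matrix.smul_apply, smul_eq_mul, coeff_X_pow_mul'] at h
  have hn : n ≤ k := by
    by_contra hn
    exact h (if_neg hn)
  rw [if_pos hn] at h
  rw [← add_assoc, ← hf j i _ h, add_assoc, ← add_smul, Nat.sub_add_cancel hn]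

theorem loc_X_pow_smul {I J : Type*} (n : ℕ) (f : Matrix J I F2[X]) :
    loc ((X ^ n : F2[X]) • f) = (T n : F2[T;T⁻¹]) • loc f := by
  ext1 j i
  simp [loc]

theorem hat_X_pow_smul {I J : Type*} {n : ℕ} (hn : n ≠ 0) (f : Matrix J I F2[X]) :
    hat ((X ^ n : F2[X]) • f) = 0 := by
  ext1 j i
  simp [hat, hn.symm]

end Degree

/-! ### The bidegree of the tower and comparison with the trivial complex -/

namespace HorizontalComplex

/-- Every horizontal complex contains a homogeneous tower generator `x` and a homogeneous cocycle
`p` which is one on it. -/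
theorem exists_homog_split (C : HorizontalComplex) :
    ∃ (s : ℤ × ℤ) (p : Matrix Unit C.gen F2[X]) (x : Matrix C.gen Unit F2[X]),
      IsHomog C.deg (fun _ => 0) (-s) p ∧ IsHomog (fun _ => 0) C.deg s x ∧
        p * C.d = 0 ∧ C.d * x = 0 ∧ p * x = 1 := by
  obtain ⟨p, x, hp, hx, hpx⟩ := C.exists_split
  have h1 : hat p * hat x = 1 := by rw [← hat_mul, hpx, hat_one]
  rw [← sum_row_degProj_column _ _ C.deg] at h1
  obtain ⟨s, hs⟩ : ∃ s, hat p * degProj C.deg s * hat x ≠ 0 := by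
    by_contra! h
    rw [Finset.sum_eq_zero fun s _ => h s] at h1
    exact zero_ne_one h1
  refine ⟨s, _, _, homogPart_isHomog p, homogPart_isHomog x, ?_, ?_, ?_⟩
  · rw [← C.d_homog.mul_homogPart, hp, homogPart_zero]
  · rw [← C.d_homog.homogPart_mul, hx, homogPart_zero]
  · refine IsHomog.eq_one_of_hat ?_ ?_
    · have := (homogPart_isHomog (dI := C.deg) (dJ := fun _ : Unit => 0) (s := -s) p).mul
        (homogPart_isHomog (dI := fun _ : Unit => 0) (dJ := C.deg) (s := s) x)
      rwa [add_neg_cancel] at this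
    · rw [hat_mul, hat_homogPart_row, hat_homogPart_column, Matrix.mul_assoc,
        ← Matrix.mul_assoc (degProj C.deg s), degProj_sq, ← Matrix.mul_assoc, eq_one_of_ne_zero hs]

theorem loc_mul_dLoc (C : HorizontalComplex) {p : Matrix Unit C.gen F2[X]} (hp : p * C.d = 0) :
    loc p * C.dLoc = 0 := by
  rw [BigradedComplex.dLoc, ← loc_mul, hp, loc_zero]

theorem dLoc_mul_loc (C : HorizontalComplex) {x : Matrix C.gen Unit F2[X]} (hx : C.d * x = 0) :
    C.dLoc * loc x = 0 := by
  rw [BigradedComplex.dLoc, ← loc_mul, hx, loc_zero]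

/-- The tower generator lies in the bidegree of a power of `U`. -/
theorem exists_degree_eq (C : HorizontalComplex) {s : ℤ × ℤ} {p : Matrix Unit C.gen F2[X]}
    {x : Matrix C.gen Unit F2[X]} (hxs : IsHomog (fun _ => 0) C.deg s x) (hp : p * C.d = 0)
    (hx : C.d * x = 0) (hpx : p * x = 1) : ∃ k : ℤ, s = k • degU := by
  obtain ⟨f, g, hf, -, hfg⟩ := C.localization
  have he := (C.isHomotopyEquiv_of_mul_eq_one (C.loc_mul_dLoc hp) (C.dLoc_mul_loc hx)
    (by rw [← loc_mul, hpx, loc_one])).1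
  obtain ⟨h, hh⟩ := IsHomotopyEquiv.comp ⟨g, hfg⟩ he
  have hne : f * loc x ≠ 0 := by
    intro h0
    have := hh.right.eq_of_zero
    rw [h0, Matrix.zero_mul] at this
    exact zero_ne_one this
  obtain ⟨j, hj⟩ : ∃ j, f () j * loc x j () ≠ 0 := by
    by_contra! h0
    apply hne
    ext1 ⟨⟩ ⟨⟩
    exact (Matrix.mul_apply ..).trans (Finset.sum_eq_zero fun j _ => h0 j)
  obtain ⟨a, ha⟩ : ∃ a, (f () j).coeff a ≠ 0 := by
    by_contra! h0
    exact left_ne_zero_of_mul hj (AddMonoidAlgebra.ext (Finsupp.ext h0))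
  obtain ⟨b, hb⟩ : ∃ b, (x j ()).coeff b ≠ 0 := by
    by_contra! h0
    refine right_ne_zero_of_mul hj ?_
    have : x j () = 0 := Polynomial.ext h0
    simp [loc, this]
  -- Since `f` preserves bidegrees, a nonzero term `U ^ a` of `f` at `j` and a nonzero term `U ^ b`
  -- of `x` at `j` place `x` in the bidegree of `U ^ (a + b)`.
  refine ⟨a + b, ?_⟩
  have h1 := hf () j a ha
  have h2 := hxs j () b hb
  rw [zero_add, add_zero] at h1
  rw [zero_add, ← h1] at h2
  rw [← h2, add_smul, natCast_zsmul]

/-- The local map sends the generator of `𝔽₂[U]` to `w`. The cocycle `r` lives over the localization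
because `w` may be `U ^ n` times a tower generator, which pairs to one only with `U ^ (-n)` times a
cocycle. -/
theorem trivial_le_of_cycle (C : HorizontalComplex) {w : Matrix C.gen Unit F2[X]}
    {r : Matrix Unit C.gen F2[T;T⁻¹]} (hw : IsHomog (fun _ => 0) C.deg 0 w) (hdw : C.d * w = 0)
    (hr : r * C.dLoc = 0) (hrw : r * loc w = 1)
    (hi : Homotopic 0 C.dHat (C.iota * hat w) (hat w)) : trivial ≤ C := by
  refine ⟨w, hw, ?_, ?_, ?_⟩
  · exact hdw.trans (Matrix.mul_zero w).symm
  · rw [trivial_dLoc]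
    exact (C.isHomotopyEquiv_of_mul_eq_one hr (C.dLoc_mul_loc hdw) hrw).1
  · rw [trivial_dHat]
    refine hi.trans (Homotopic.of_eq (Matrix.mul_one _).symm)

theorem le_trivial_of_cocycle (C : HorizontalComplex) {p : Matrix Unit C.gen F2[X]}
    {q : Matrix C.gen Unit F2[T;T⁻¹]} (hp : IsHomog C.deg (fun _ => 0) 0 p) (hpd : p * C.d = 0)
    (hq : C.dLoc * q = 0) (hpq : loc p * q = 1)
    (hi : Homotopic C.dHat 0 (hat p) (hat p * C.iota)) : C ≤ trivial := by
  refine ⟨p, hp, ?_, ?_, ?_⟩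
  · exact (Matrix.zero_mul p).trans hpd.symm
  · rw [trivial_dLoc]
    exact (C.isHomotopyEquiv_of_mul_eq_one (C.loc_mul_dLoc hpd) hq hpq).2
  · rw [trivial_dHat]
    exact (Homotopic.of_eq (Matrix.one_mul _)).trans hi

theorem X_pow_scaled_pairing {I : Type*} [Fintype I] {p : Matrix Unit I F2[X]}
    {x : Matrix I Unit F2[X]} (h : p * x = 1) (n : ℕ) :
    ((T (-n : ℤ) : F2[T;T⁻¹]) • loc p) * loc ((X ^ n : F2[X]) • x) = 1 ∧
      loc ((X ^ n : F2[X]) • p) * ((T (-n : ℤ) : F2[T;T⁻¹]) • loc x) = 1 := by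
  have hT : (T (-n : ℤ) * T n : F2[T;T⁻¹]) = 1 := by rw [← T_add]; simp
  have hT' : (T n * T (-n : ℤ) : F2[T;T⁻¹]) = 1 := by rw [← T_add]; simp
  constructor <;>
  · rw [loc_X_pow_smul, Matrix.smul_mul, Matrix.mul_smul, smul_smul, ← loc_mul, h, loc_one]
    simp only [hT, hT', one_smul]

/-- A complex whose tower does not start in bidegree zero is comparable with the trivial complex. -/
theorem comparable_or_exists_split (C : HorizontalComplex) :
    trivial ≤ C ∨ C ≤ trivial ∨ ∃ (p : Matrix Unit C.gen F2[X]) (x : Matrix C.gen Unit F2[X]),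
      IsHomog C.deg (fun _ => 0) 0 p ∧ IsHomog (fun _ => 0) C.deg 0 x ∧
        p * C.d = 0 ∧ C.d * x = 0 ∧ p * x = 1 := by
  obtain ⟨s, p, x, hps, hxs, hp, hx, hpx⟩ := C.exists_homog_split
  obtain ⟨k, rfl⟩ := C.exists_degree_eq hxs hp hx hpx
  obtain hk | rfl | hk := lt_trichotomy k 0
  -- Multiplying `x` by `U ^ n` moves it to bidegree zero. As `n` is positive it dies modulo `U`, so
  -- compatibility with `ι` is automatic. For positive `k` the same is done to the cocycle `p`.
  · obtain ⟨n, rfl⟩ : ∃ n : ℕ, k = -n := ⟨k.natAbs, by omega⟩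
    have hn : n ≠ 0 := by omega
    left
    refine C.trivial_le_of_cycle (w := (X ^ n : F2[X]) • x) ?_ ?_ ?_
      (X_pow_scaled_pairing hpx n).1 (Homotopic.of_eq ?_)
    · simpa using hxs.X_pow_smul n
    · rw [Matrix.mul_smul, hx, smul_zero]
    · rw [Matrix.smul_mul, C.loc_mul_dLoc hp, smul_zero]
    · rw [hat_X_pow_smul hn, Matrix.mul_zero]
  · right; right
    exact ⟨p, x, by simpa using hps, by simpa using hxs, hp, hx, hpx⟩
  · obtain ⟨n, rfl⟩ : ∃ n : ℕ, k = n := ⟨k.natAbs, by omega⟩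
    have hn : n ≠ 0 := by omega
    right; left
    refine C.le_trivial_of_cocycle (p := (X ^ n : F2[X]) • p) ?_ ?_ ?_
      (X_pow_scaled_pairing hpx n).2 (Homotopic.of_eq ?_)
    · simpa using hps.X_pow_smul n
    · rw [Matrix.smul_mul, hp, smul_zero]
    · rw [Matrix.mul_smul, C.dLoc_mul_loc hx, smul_zero]
    · rw [hat_X_pow_smul hn, Matrix.zero_mul]

end HorizontalComplex

/-! ### Linear alternative, constant lifts and division by `U` -/

/-- The row space of `A` is the annihilator of its kernel: a functional is a combination of the rows
unless some kernel vector detects it. -/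
theorem exists_row_or_column {K m n : Type*} [Field K] [Fintype m] [Fintype n] [DecidableEq m]
    [DecidableEq n] (A : Matrix m n K) (r : Matrix Unit n K) :
    (∃ t : Matrix Unit m K, t * A = r) ∨ ∃ v : Matrix n Unit K, A * v = 0 ∧ r * v ≠ 0 := by
  by_cases h : ∀ v : n → K, A *ᵥ v = 0 → r *ᵥ v = 0
  · left
    let ρ : Module.Dual K (n → K) := LinearMap.proj () ∘ₗ r.mulVecLin
    have hρ : ρ ∈ LinearMap.range A.mulVecLin.dualMap := by
      rw [LinearMap.range_dualMap_eq_dualAnnihilator_ker, Submodule.mem_dualAnnihilator]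
      intro v hv
      exact congrFun (h v hv) ()
    obtain ⟨τ, hτ⟩ := hρ
    refine ⟨LinearMap.toMatrix' (LinearMap.pi fun _ => τ), Matrix.ext_of_mulVec_single fun i => ?_⟩
    rw [← Matrix.mulVec_mulVec, ← Matrix.toLin'_apply, Matrix.toLin'_toMatrix']
    ext ⟨⟩
    exact LinearMap.congr_fun hτ (Pi.single i 1)
  · right
    push Not at h
    obtain ⟨v, hv, hrv⟩ := h
    refine ⟨Matrix.of fun i _ => v i, ?_, fun h0 => hrv ?_⟩
    · ext i ⟨⟩
      exact congrFun hv i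
    · ext ⟨⟩
      exact congrFun (congrFun h0 ()) ()

section Lifts

variable {I J K : Type*}

/-- The lift of a map of hat-flavored truncations with constant coefficients. -/
def constLift (v : Matrix J I F2) : Matrix J I F2[X] := v.map Polynomial.C

theorem hat_constLift (v : Matrix J I F2) : hat (constLift v) = v := by
  ext j i
  simp [hat, constLift]

theorem constLift_isHomog {dI : I → ℤ × ℤ} {dJ : J → ℤ × ℤ} {s : ℤ × ℤ} {v : Matrix J I F2}
    (h : ∀ j i, v j i ≠ 0 → dJ j = dI i + s) : IsHomog dI dJ s (constLift v) := by
  intro j i k hk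
  rw [constLift, Matrix.map_apply, coeff_C] at hk
  obtain ⟨rfl, hk⟩ := ite_ne_right_iff.1 hk
  simpa using h j i hk

/-- Division of a map by `U`, forgetting its constant coefficients. -/
def divU (f : Matrix J I F2[X]) : Matrix J I F2[X] := f.map divX

theorem X_smul_divU {f : Matrix J I F2[X]} (h : hat f = 0) : (X : F2[X]) • divU f = f := by
  ext1 j i
  have h0 : (f j i).coeff 0 = 0 := congrFun (congrFun h j) i
  conv_rhs => rw [← divX_mul_X_add (f j i), h0, C_0, add_zero, mul_comm]
  rfl

theorem IsHomog.divU {dI : I → ℤ × ℤ} {dJ : J → ℤ × ℤ} {s : ℤ × ℤ} {f : Matrix J I F2[X]}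
    (hf : IsHomog dI dJ s f) : IsHomog dI dJ (s - degU) (divU f) := by
  intro j i k h
  rw [HorizontalIota.divU, Matrix.map_apply, coeff_divX] at h
  have := hf j i _ h
  rw [add_smul, one_smul, ← add_assoc, ← eq_sub_iff_add_eq] at this
  rw [this, add_sub_assoc]

/-- Both sides extract the coefficient of `U` in `d`. This is how `Φ` enters: if `v` is a cycle
modulo `U`, then `∂v/U` reduces to `Φv`. -/
theorem hat_divU_mul_constLift [Fintype J] (d : Matrix K J F2[X]) (v : Matrix J I F2) :
    hat (divU (d * constLift v)) = hat (formalDeriv d) * v := by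
  ext k i
  simp [hat, divU, formalDeriv, constLift, Matrix.mul_apply, finsetSum_coeff, coeff_divX,
    coeff_derivative]

end Lifts

/-- Homotopies of maps out of a complex with zero differential can be found one basis vector at a
time. -/
theorem Homotopic.of_columns {R I J : Type*} [CommRing R] [Fintype I] [Fintype J]
    {d : Matrix J J R} {f g : Matrix J I R}
    (h : ∀ i, Homotopic (0 : Matrix Unit Unit R) d (f.submatrix id fun _ => i)
      (g.submatrix id fun _ => i)) : Homotopic 0 d f g := by
  choose k hk using h
  refine ⟨Matrix.of fun j i => k i j (), ?_⟩
  ext j i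
  have := congrFun (congrFun (hk i) j) ()
  simpa [Matrix.mul_apply] using this

/-! ### Almost local maps out of the figure-eight complex -/

namespace HorizontalComplex

/-- Homotopy of cycles of the hat-flavored truncation, that is, homology. -/
abbrev Homologous (C : HorizontalComplex) (v w : Matrix C.gen Unit F2) : Prop :=
  Homotopic (0 : Matrix Unit Unit F2) C.dHat v w

section FigEightCycle

variable {C : HorizontalComplex} {v w : Matrix C.gen Unit F2}

/-- By the formula for `ι²` the error term is `ΦιΦιΦv`. Exchanging `ιΦιΦ` for `ΦιΦι` puts two copies
of `Φ` side by side, and `Φ² ∼ 0`. This is the relation `ι(c) = b`. -/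
theorem iota_iota_phi_homologous (hv : C.dHat * v = 0) :
    C.Homologous (C.iota * (C.iota * (C.phi * v))) (C.phi * v) := by
  have cv : IsChainMap (0 : Matrix Unit Unit F2) C.dHat v := by
    rw [IsChainMap, hv, Matrix.mul_zero]
  have rC := C.hatRel
  have h1 := Homotopic.mul_right (rC.chain_phi.mul cv) C.iota_sq
  have h2 := Homotopic.mul_left rC.chain_phi (Homotopic.mul_right cv C.iota_comm)
  have h3 := Homotopic.mul_right
    (rC.chain_iota.mul (rC.chain_phi.mul (rC.chain_iota.mul cv))) C.phi_sq
  simp only [Matrix.mul_assoc, Matrix.add_mul, Matrix.one_mul, Matrix.zero_mul] at h1 h2 h3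
  refine h1.trans ?_
  have := (Homotopic.refl (dC := (0 : Matrix Unit Unit F2)) (dD := C.dHat) (C.phi * v)).add
    (h2.symm.trans h3)
  rwa [add_zero] at this

/-- The difference of the two sides is `ΦιΦw`, which is null-homologous because `Φw` is. -/
theorem phi_iota_phi_iota_homologous (hφ : C.Homologous (C.phi * w) 0)
    (h : C.iota * v = v + w) :
    C.Homologous (C.phi * (C.iota * (C.phi * (C.iota * v)))) (C.phi * (C.iota * (C.phi * v))) := by
  have rC := C.hatRel
  have h1 := Homotopic.mul_left rC.chain_phi (Homotopic.mul_left rC.chain_iota hφ)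
  have h2 := (Homotopic.refl (dC := (0 : Matrix Unit Unit F2)) (dD := C.dHat)
    (C.phi * (C.iota * (C.phi * v)))).add h1
  simp only [Matrix.mul_zero, add_zero] at h2
  rw [h]
  simpa only [Matrix.mul_add] using h2

/-- With `ΦιΦv` as the image of `d`, this is the relation `ι(d) = d`. -/
theorem iota_phi_iota_phi_homologous (hv : C.dHat * v = 0)
    (hφ : C.Homologous (C.phi * w) 0) (h : C.iota * v = v + w) :
    C.Homologous (C.iota * (C.phi * (C.iota * (C.phi * v)))) (C.phi * (C.iota * (C.phi * v))) := by
  have cv : IsChainMap (0 : Matrix Unit Unit F2) C.dHat v := by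
    rw [IsChainMap, hv, Matrix.mul_zero]
  have h1 := Homotopic.mul_right cv C.iota_comm
  simp only [Matrix.mul_assoc] at h1
  exact h1.symm.trans (phi_iota_phi_iota_homologous hφ h)

/-- Apply `ι` to `w = v + ιv` and expand `ι²v` as `v + ΦιΦιv`. This is the relation `ι(x) = x + d`.
-/
theorem iota_homologous_add (hv : C.dHat * v = 0)
    (hφ : C.Homologous (C.phi * w) 0) (h : C.iota * v = v + w) :
    C.Homologous (C.iota * w) (w + C.phi * (C.iota * (C.phi * v))) := by
  have cv : IsChainMap (0 : Matrix Unit Unit F2) C.dHat v := by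
    rw [IsChainMap, hv, Matrix.mul_zero]
  have h1 := Homotopic.mul_right cv C.iota_sq
  simp only [Matrix.mul_assoc, Matrix.add_mul, Matrix.one_mul] at h1
  have hw' : w = v + C.iota * v := by
    rw [h, ← add_assoc, add_self_zero, zero_add]
  have h2 : C.iota * w = C.iota * (C.iota * v) + (v + w) := by
    conv_lhs => rw [hw', Matrix.mul_add, h, Matrix.mul_add]
    rw [h, Matrix.mul_add, h]
    abel
  have h3 : w + C.phi * (C.iota * (C.phi * v)) =
      (v + C.phi * (C.iota * (C.phi * v))) + (v + w) := by
    have := add_self_zero v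
    calc _ = w + C.phi * (C.iota * (C.phi * v)) + (v + v) := by rw [this, add_zero]
      _ = _ := by abel
  rw [h2, h3]
  exact (h1.trans ((Homotopic.refl v).add (phi_iota_phi_iota_homologous hφ h))).add
    (Homotopic.refl _)

end FigEightCycle

/-- The map from the figure-eight complex with prescribed images of `a`, `c` and `x`. -/
def figEightMap (C : HorizontalComplex) (v : Matrix C.gen Unit F2) (w : Matrix C.gen Unit F2[X]) :
    Matrix C.gen (Fin 5) F2[X] :=
  Matrix.of fun i => ![constLift v i (), divU (C.d * constLift v) i (),
    constLift (C.iota * (C.phi * v)) i (),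
    divU (C.d * constLift (C.iota * (C.phi * v))) i (), w i ()]

/-- A cycle `v` of bidegree zero of the truncation with `(1 + ι) v` the reduction of a tower
generator `w` defines an almost local map from the figure-eight complex. -/
theorem figEight_le (C : HorizontalComplex) {p : Matrix Unit C.gen F2[X]}
    {w : Matrix C.gen Unit F2[X]} {v : Matrix C.gen Unit F2} (hp : p * C.d = 0)
    (hw : C.d * w = 0) (hpw : p * w = 1) (hw0 : IsHomog (fun _ => 0) C.deg 0 w)
    (hv0 : ∀ i u, v i u ≠ 0 → C.deg i = 0) (hv : C.dHat * v = 0)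
    (h : C.iota * v = v + hat w) : figEight ≤ C := by
  have rC := C.hatRel
  -- The cycle `w` is a chain map from a complex with zero differential, where `Φ` is zero.
  -- Naturality of `Φ` gives the claim.
  have hφ : C.Homologous (C.phi * hat w) 0 := by
    have cw : IsChainMap (0 : Matrix Unit Unit F2[X]) C.d w := by
      rw [IsChainMap, hw, Matrix.mul_zero]
    have h1 := (phi_natural cw).map (constantCoeff : F2[X] →+* F2)
    have h2 : formalDeriv (0 : Matrix Unit Unit F2[X]) = 0 := by ext1; simp [formalDeriv]
    rw [h2, Matrix.mul_zero, Matrix.map_zero _ (map_zero _), Matrix.map_zero _ (map_zero _),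
      Matrix.map_mul] at h1
    exact h1
  set b := C.phi * v with hb
  set c := C.iota * b with hc
  have hcd : C.dHat * c = 0 := by
    rw [hc, hb, ← Matrix.mul_assoc, rC.chain_iota, Matrix.mul_assoc, ← Matrix.mul_assoc C.dHat,
      rC.chain_phi, Matrix.mul_assoc, hv, Matrix.mul_zero, Matrix.mul_zero]
  have hA : ∀ u : Matrix C.gen Unit F2, C.dHat * u = 0 → hat (C.d * constLift u) = 0 := by
    intro u hu
    rw [hat_mul, hat_constLift]
    exact hu
  have hb1 : ∀ i u, b i u ≠ 0 → C.deg i = (1, 1) := by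
    intro i u hi
    obtain ⟨j, -, hj⟩ := Finset.exists_ne_zero_of_sum_ne_zero hi
    rw [C.phi_deg (left_ne_zero_of_mul hj), hv0 _ _ (right_ne_zero_of_mul hj), zero_add]
  have hc1 : ∀ i u, c i u ≠ 0 → C.deg i = (-1, -1) := by
    intro i u hi
    obtain ⟨j, -, hj⟩ := Finset.exists_ne_zero_of_sum_ne_zero hi
    rw [C.iota_skew _ _ (left_ne_zero_of_mul hj), hb1 _ _ (right_ne_zero_of_mul hj)]
    rfl
  have gA : IsHomog (fun _ : Unit => 0) C.deg 0 (constLift v) :=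
    constLift_isHomog fun j i hji => by rw [hv0 j i hji]; rfl
  have gC : IsHomog (fun _ : Unit => 0) C.deg (-1, -1) (constLift c) :=
    constLift_isHomog fun j i hji => by rw [hc1 j i hji]; rfl
  -- The differential adds `(0, -1)` and division by `U` adds `(1, 2)`, so the images of `b` and `d`
  -- get the bidegrees `(1, 1)` and `(0, 0)`.
  have gB := (C.d_homog.mul gA).divU
  have gD := (C.d_homog.mul gC).divU
  have hF0 : hat (figEightMap C v w) = Matrix.of fun i => ![v i (), b i (), c i (),
      (C.phi * c) i (), hat w i ()] := by
    have e1 := hat_constLift v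
    have e2 : hat (divU (C.d * constLift v)) = b := hat_divU_mul_constLift C.d v
    have e3 := hat_constLift c
    have e4 : hat (divU (C.d * constLift c)) = C.phi * c := hat_divU_mul_constLift C.d c
    ext1 i j
    fin_cases j
    · exact congrFun (congrFun e1 i) ()
    · exact congrFun (congrFun e2 i) ()
    · exact congrFun (congrFun e3 i) ()
    · exact congrFun (congrFun e4 i) ()
    · rfl
  have chain : IsChainMap figEight.d C.d (figEightMap C v w) := by
    have hX : ∀ u : Matrix C.gen Unit F2, C.dHat * u = 0 →
        C.d * constLift u = (X : F2[X]) • divU (C.d * constLift u) :=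
      fun u hu => (X_smul_divU (hA u hu)).symm
    -- Multiplication by `U` is injective, and `U` times the left side is `∂²` of the lift.
    have hX0 : ∀ u : Matrix C.gen Unit F2, C.dHat * u = 0 →
        C.d * divU (C.d * constLift u) = 0 := fun u hu => by
      refine smul_right_injective _ (X_ne_zero (R := F2)) ?_
      dsimp only
      rw [← Matrix.mul_smul, ← hX u hu, ← Matrix.mul_assoc, C.d_sq, Matrix.zero_mul, smul_zero]
    have hcol : ∀ i j, (figEightMap C v w * figEightD) i j =
        ![X * figEightMap C v w i 1, 0, X * figEightMap C v w i 3, 0, 0] j := by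
      intro i j
      fin_cases j <;> simp [figEightD, Matrix.mul_apply, Fin.sum_univ_five, mul_comm]
    ext1 i j
    refine Eq.trans ?_ (hcol i j).symm
    fin_cases j
    · exact congrFun (congrFun (hX v hv) i) ()
    · exact congrFun (congrFun (hX0 v hv) i) ()
    · exact congrFun (congrFun (hX c hcd) i) ()
    · exact congrFun (congrFun (hX0 c hcd) i) ()
    · exact congrFun (congrFun hw i) ()
  refine ⟨figEightMap C v w, ?_, chain, ?_, ?_⟩
  · intro i j k hk
    fin_cases j
    · exact gA i () k hk
    · exact gB i () k hk
    · exact gC i () k hk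
    · exact gD i () k hk
    · exact hw0 i () k hk
  -- The column `e` is the generator `x`, sent to `w`. Both `e` and `w` pair to one with a cocycle
  -- (`p` pulled back, and `p`), so both are equivalences after localization and two-out-of-three
  -- applies.
  · let e : Matrix (Fin 5) Unit F2[X] := Matrix.of fun i _ => ![0, 0, 0, 0, 1] i
    have he : figEightMap C v w * e = w := by
      ext1 i ⟨⟩
      simp [figEightMap, e, Matrix.mul_apply, Fin.sum_univ_five]
    have hde : figEight.d * e = 0 := by
      ext1 i ⟨⟩
      fin_cases i <;> simp [figEightD, e, Matrix.mul_apply, Fin.sum_univ_five]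
    have hpF : p * figEightMap C v w * figEight.d = 0 := by
      rw [Matrix.mul_assoc, ← chain, ← Matrix.mul_assoc, hp, Matrix.zero_mul]
    have h1 := (figEight.isHomotopyEquiv_of_mul_eq_one (figEight.loc_mul_dLoc hpF)
      (figEight.dLoc_mul_loc hde) (by rw [← loc_mul, Matrix.mul_assoc, he, hpw, loc_one])).1
    have h2 := (C.isHomotopyEquiv_of_mul_eq_one (C.loc_mul_dLoc hp) (C.dLoc_mul_loc hw)
      (by rw [← loc_mul, hpw, loc_one])).1
    rw [← he, loc_mul] at h2
    exact IsHomotopyEquiv.of_comp_right (chain.map _) h1 h2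
  · rw [figEight_dHat]
    refine Homotopic.of_columns fun j => ?_
    have hcol : ∀ i j, (hat (figEightMap C v w) * figEightIota) i j =
        ![v i () + hat w i (), c i (), b i (), (C.phi * c) i (),
          hat w i () + (C.phi * c) i ()] j := by
      intro i j
      rw [hF0]
      fin_cases j <;> simp [figEightIota, Matrix.mul_apply, Fin.sum_univ_five, add_comm]
    -- The compatibility with `ι` is now one homology relation per generator `a, b, c, d, x`.
    have close : ∀ (j : Fin 5) (a u : Matrix C.gen Unit F2),
        (∀ i, a i () = hat (figEightMap C v w) i j) →
        (∀ i, (hat (figEightMap C v w) * figEightIota) i j = u i ()) →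
        C.Homologous (C.iota * a) u →
        Homotopic 0 C.dHat ((C.iota * hat (figEightMap C v w)).submatrix id fun _ : Unit => j)
          ((hat (figEightMap C v w) * figEightIota).submatrix id fun _ : Unit => j) := by
      intro j a u ha hu hau
      have ha' : a = (hat (figEightMap C v w)).submatrix id fun _ => j := by
        ext i ⟨⟩
        exact ha i
      have hu' : (hat (figEightMap C v w) * figEightIota).submatrix id (fun _ => j) = u := by
        ext i ⟨⟩
        exact hu i
      rw [hu']
      rw [ha'] at hau
      exact hau
    rw [hF0] at close hcol ⊢
    fin_cases j
    · exact close 0 v _ (fun _ => rfl) (fun i => hcol i 0) (Homotopic.of_eq h)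
    · exact close 1 b c (fun _ => rfl) (fun i => hcol i 1) (Homotopic.refl _)
    · exact close 2 c b (fun _ => rfl) (fun i => hcol i 2) (iota_iota_phi_homologous hv)
    · exact close 3 (C.phi * c) _ (fun _ => rfl) (fun i => hcol i 3)
        (iota_phi_iota_phi_homologous hv hφ h)
    · exact close 4 (hat w) (hat w + C.phi * c) (fun _ => rfl) (fun i => hcol i 4)
        (iota_homologous_add hv hφ h)

end HorizontalComplex

/-! ### The dichotomy, and the figure-eight complex against zero -/

namespace HorizontalComplex

/-- A complex whose tower starts in bidegree zero lies below the trivial complex or above the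
figure-eight complex. -/
theorem le_trivial_or_figEight_le (C : HorizontalComplex) {p : Matrix Unit C.gen F2[X]}
    {x : Matrix C.gen Unit F2[X]} (hp0 : IsHomog C.deg (fun _ => 0) 0 p)
    (hp : p * C.d = 0) (hx0 : IsHomog (fun _ => 0) C.deg 0 x) (hx : C.d * x = 0)
    (hpx : p * x = 1) : C ≤ trivial ∨ figEight ≤ C := by
  obtain ⟨σ, h1, h2⟩ := exists_ker_complement C.d
  set ω : Matrix C.gen C.gen F2 := 1 + C.iota with hω
  set P := degProj C.deg 0 with hP
  set Q := degProj C.deg (0, -1) with hQ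
  -- Although `ι` is only skew-graded, the skew action on bidegrees fixes zero and sends nothing
  -- else there, so `1 + ι` respects the part of bidegree zero.
  have hωP : ω * P = P * ω := by
    rw [hω, Matrix.add_mul, Matrix.mul_add, Matrix.one_mul, Matrix.mul_one]
    congr 1
    refine mul_degProj_eq fun j i hji => ?_
    rw [C.iota_skew j i hji]
    constructor
    · intro h
      rw [h]
      rfl
    · intro h
      have e1 := congrArg Prod.fst h
      have e2 := congrArg Prod.snd h
      simp only [skew, Prod.fst_zero, Prod.snd_zero] at e1 e2
      ext <;> simp only [Prod.fst_zero, Prod.snd_zero] <;> omega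
  have hdP : C.dHat * P = Q * C.dHat := by
    refine mul_degProj_eq fun j i hji => ?_
    rw [C.d_homog.hat hji]
    exact ⟨fun h => by rw [h, zero_add], fun h => add_eq_right.1 h⟩
  have hpP : hat p * P = hat p := by
    have := hat_homogPart_row (dI := C.deg) p 0
    rw [neg_zero, hp0.homogPart_eq] at this
    exact this.symm
  have hσd : σ * C.d = 0 := h2 _ C.d_sq
  -- The kernel of the stacked matrix consists of the cycles `v` of `C/U` for which `(1 + ι) v` is
  -- killed by the reduction of `σ`, which makes it the reduction of a cycle of `C`. The functional
  -- tested on them is `p (1 + ι)`.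
  obtain ⟨t, ht⟩ | ⟨v, hv, hpv⟩ :=
    exists_row_or_column (Matrix.fromRows (hat σ * ω) C.dHat) (hat p * ω)
  · left
    obtain ⟨θ, η, rfl⟩ : ∃ (θ η : Matrix Unit C.gen F2), t = Matrix.fromCols θ η :=
      ⟨t.toCols₁, t.toCols₂, (Matrix.fromCols_toCols t).symm⟩
    rw [Matrix.fromCols_mul_fromRows] at ht
    -- The correction vanishes on all cycles of `C`, boundaries included, so `q` is still a cocycle
    -- with value one on `x`. It is chosen to leave only the multiple `η` of the differential in `q
    -- (1 + ι)`.
    set q := p + constLift θ * σ with hq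
    have hqd : q * C.d = 0 := by
      rw [hq, Matrix.add_mul, hp, Matrix.mul_assoc, hσd, Matrix.mul_zero, add_zero]
    have hqx : q * x = 1 := by
      rw [hq, Matrix.add_mul, hpx, Matrix.mul_assoc, h2 x hx, Matrix.mul_zero, add_zero]
    have hqω : hat q * ω = η * C.dHat := by
      rw [hq, hat_add, hat_mul, hat_constLift, Matrix.add_mul, ← ht, Matrix.mul_assoc θ,
        add_right_comm, add_self_zero, zero_add]
    -- The homotopy is `η` cut down to bidegree `(0, -1)`, where the differential sends bidegree
    -- zero.
    refine C.le_trivial_of_cocycle (p := homogPart C.deg (fun _ => 0) 0 q) (q := loc x)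
      (homogPart_isHomog q) ?_ (C.dLoc_mul_loc hx) ?_ ⟨η * Q, ?_⟩
    · rw [← C.d_homog.mul_homogPart, hqd, homogPart_zero]
    · rw [← loc_mul, ← hx0.mul_homogPart, hqx, add_zero, IsHomog.one.homogPart_eq, loc_one]
    · have hh := hat_homogPart_row (dI := C.deg) q 0
      rw [neg_zero] at hh
      have key : hat q * P * ω = η * Q * C.dHat := by
        rw [Matrix.mul_assoc, ← hωP, ← Matrix.mul_assoc, hqω, Matrix.mul_assoc, hdP,
          Matrix.mul_assoc]
      rw [hh, ← hP, Matrix.zero_mul, zero_add, ← key, hω, Matrix.mul_add, Matrix.mul_one,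
        add_left_comm, add_self_zero, add_zero]
  · right
    rw [Matrix.fromRows_mul] at hv
    have hv1 : hat σ * (ω * v) = 0 := by
      rw [← Matrix.mul_assoc]
      ext i u
      exact congrFun (congrFun hv (Sum.inl i)) u
    have hv2 : C.dHat * v = 0 := by
      ext i u
      exact congrFun (congrFun hv (Sum.inr i)) u
    -- In characteristic two `1 + σ` is the projection onto cycles. It does not change the
    -- reduction, since `σ` kills `(1 + ι) v` modulo `U`.
    set y := (1 + σ) * constLift (ω * v) with hy
    have hdy : C.d * y = 0 := by
      rw [hy, ← Matrix.mul_assoc, Matrix.mul_add, Matrix.mul_one, h1, add_self_zero,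
        Matrix.zero_mul]
    have hhy : hat y = ω * v := by
      rw [hy, hat_mul, hat_add, hat_one, hat_constLift, Matrix.add_mul, hv1, Matrix.one_mul,
        add_zero]
    have hwy : hat (homogPart (fun _ => 0) C.deg 0 y) = ω * (P * v) := by
      rw [hat_homogPart_column, hhy, ← Matrix.mul_assoc, ← Matrix.mul_assoc, hωP]
    refine C.figEight_le (p := p) (w := homogPart (fun _ => 0) C.deg 0 y) (v := P * v) hp ?_ ?_
      (homogPart_isHomog y) ?_ ?_ ?_
    · rw [← C.d_homog.homogPart_mul, hdy, homogPart_zero]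
    · refine IsHomog.eq_one_of_hat ?_ ?_
      · have := hp0.mul (homogPart_isHomog (dI := fun _ : Unit => 0) (dJ := C.deg) (s := 0) y)
        rwa [add_zero] at this
      · rw [hat_mul, hwy, ← Matrix.mul_assoc ω, hωP, Matrix.mul_assoc P, ← Matrix.mul_assoc, hpP,
          ← Matrix.mul_assoc]
        exact eq_one_of_ne_zero hpv
    · intro i u hi
      rw [degProj_mul_apply] at hi
      exact (ite_ne_right_iff.1 hi).1
    · rw [← Matrix.mul_assoc, hdP, Matrix.mul_assoc, hv2, Matrix.mul_zero]
    · rw [hwy, hω, Matrix.add_mul, Matrix.one_mul, ← add_assoc, add_self_zero, zero_add]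

theorem figEight_le_of_not_comparable (C : HorizontalComplex) (h1 : ¬ trivial ≤ C)
    (h2 : ¬ C ≤ trivial) : figEight ≤ C := by
  obtain h | h | ⟨p, x, hp0, hx0, hp, hx, hpx⟩ := C.comparable_or_exists_split
  · exact absurd h h1
  · exact absurd h h2
  · exact (C.le_trivial_or_figEight_le hp0 hp hx0 hx hpx).resolve_left h2

/-- A local map is nonzero on `x`, which generates the tower. Yet commuting with `ι` at `a`, where
`ι(a) = a + x`, forces it to vanish on `x` modulo `U`. -/
theorem not_figEight_le_trivial : ¬ figEight ≤ trivial := by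
  rintro ⟨φ, hφ⟩
  obtain ⟨g, hg⟩ := hφ.isLocal
  have hd : figEight.dLoc = !![0, 0, 0, 0, 0; T 1, 0, 0, 0, 0; 0, 0, 0, 0, 0;
      0, 0, T 1, 0, 0; 0, 0, 0, 0, 0] := by
    ext1 i j
    fin_cases i <;> fin_cases j <;> simp [BigradedComplex.dLoc, loc, figEightD]
  have hone : loc φ * g = 1 := by
    have := hg.right
    rw [trivial_dLoc] at this
    exact this.eq_of_zero
  have hφd : loc φ * figEight.dLoc = 0 := by
    have := hg.chain_f
    rw [IsChainMap, trivial_dLoc] at this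
    exact this.symm.trans (Matrix.zero_mul _)
  have hdg : figEight.dLoc * g = 0 := by
    have := hg.chain_g
    rw [IsChainMap, trivial_dLoc] at this
    exact this.trans (Matrix.mul_zero _)
  rw [hd] at hφd hdg
  have hT : (T 1 : F2[T;T⁻¹]) ≠ 0 := (isUnit_T 1).ne_zero
  -- After inverting `U`, `b` and `d` are boundaries, so `φ` kills them, and the cycle `g` has no
  -- component along `a` or `c`. Only the component along `x` is left to make `φ g = 1`.
  have b0 : loc φ () 1 = 0 := by
    have := congrFun (congrFun hφd ()) 0
    simpa [Matrix.mul_apply, Fin.sum_univ_five, hT] using this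
  have d0 : loc φ () 3 = 0 := by
    have := congrFun (congrFun hφd ()) 2
    simpa [Matrix.mul_apply, Fin.sum_univ_five, hT] using this
  have a0 : g 0 () = 0 := by
    have := congrFun (congrFun hdg 1) ()
    simpa [Matrix.mul_apply, Fin.sum_univ_five, hT] using this
  have c0 : g 2 () = 0 := by
    have := congrFun (congrFun hdg 3) ()
    simpa [Matrix.mul_apply, Fin.sum_univ_five, hT] using this
  have hx : φ () 4 ≠ 0 := by
    intro h0
    have := congrFun (congrFun hone ()) ()
    have h4 : loc φ () 4 = 0 := by simp [loc, h0]
    simp [Matrix.mul_apply, Fin.sum_univ_five, a0, b0, c0, d0, h4] at this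
  -- Both `x` and the target generator have bidegree zero, so `φ x` is a constant and survives
  -- modulo `U`.
  have hx' : hat φ () 4 ≠ 0 := by
    intro h0
    apply hx
    ext k
    by_contra hk
    have := hφ.homog () 4 k hk
    have hk0 : k = 0 := nsmul_degU_eq_zero ((zero_add _).symm.trans (this.trans rfl))
    subst hk0
    exact hk (h0.trans (coeff_zero 0).symm)
  have hc := hφ.comm
  rw [figEight_dHat, trivial_dHat] at hc
  have := congrFun (congrFun hc.eq_of_zero ()) 0
  simp [Matrix.mul_apply, Fin.sum_univ_five, figEightIota] at this
  exact hx' this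

/-- The bijection of the basis of the figure-eight complex with its dual basis. -/
def figEightDualEquiv : Fin 5 ≃ Fin 5 :=
  ⟨![3, 2, 1, 0, 4], ![3, 2, 1, 0, 4], by decide, by decide⟩

theorem figEightD_submatrix : figEightD.submatrix figEightDualEquiv figEightDualEquiv =
    figEightDᵀ := by
  ext1 i j
  fin_cases i <;> fin_cases j <;> simp [figEightD, figEightDualEquiv]

/-- Transposition reverses the arrows of `∂` and of `ι`; exchanging `a` with `d` and `b` with `c`
restores both. The complex is thus isomorphic to its dual, with no homotopy needed. -/
theorem figEight_dual_le : figEight.dual ≤ figEight :=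
  equiv_of_equiv (C := figEight.dual) (D := figEight) figEightDualEquiv (by decide)
    figEightD_submatrix (Homotopic.of_eq (by decide))

theorem figEight_le_dual : figEight ≤ figEight.dual :=
  equiv_of_equiv (C := figEight) (D := figEight.dual) figEightDualEquiv (by decide)
    (congrArg Matrix.transpose figEightD_submatrix) (Homotopic.of_eq (by decide))

end HorizontalComplex

/-! ### Incomparability in the ordered group -/

namespace LocalClass

theorem add_le_add_right' {x y : LocalClass} (h : x ≤ y) (z : LocalClass) : x + z ≤ y + z := by
  induction x, y, z using Quotient.inductionOn₃ with
  | _ A B C => exact HorizontalComplex.tensor_mono (C := A) (C' := B) h le_rfl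

instance : IsOrderedAddMonoid LocalClass where
  add_le_add_left _ _ h z := add_le_add_right' h z

theorem figEight_le_of_incomparable {x : LocalClass} (h : Incomparable x 0) : figEight ≤ x := by
  induction x using Quotient.inductionOn with
  | _ C => exact C.figEight_le_of_not_comparable h.2 h.1

theorem neg_figEight : -figEight = figEight := by
  exact le_antisymm HorizontalComplex.figEight_dual_le HorizontalComplex.figEight_le_dual

theorem incomparable_figEight_zero : Incomparable figEight 0 := by
  have h : ¬ figEight ≤ 0 := HorizontalComplex.not_figEight_le_trivial
  refine ⟨h, fun h' => h ?_⟩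
  rw [← neg_figEight]
  exact neg_nonpos.2 h'

theorem incomparable_zero_iff {x : LocalClass} : Incomparable x 0 ↔ x = figEight := by
  refine ⟨fun h => le_antisymm ?_ (figEight_le_of_incomparable h), ?_⟩
  -- Negation reverses the order, so `-x` is incomparable with zero as well. Negating the bound
  -- obtained for it gives the upper bound on `x`.
  · have : figEight ≤ -x := figEight_le_of_incomparable
      ⟨fun h' => h.2 (neg_nonpos.1 h'), fun h' => h.1 (neg_nonneg.1 h')⟩
    rw [← neg_figEight]
    exact le_neg.1 this
  · rintro rfl
    exact incomparable_figEight_zero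

theorem incomparable_iff {x y : LocalClass} : Incomparable x y ↔ x = y + figEight := by
  rw [add_comm, ← sub_eq_iff_eq_add, ← incomparable_zero_iff, Incomparable, Incomparable,
    sub_nonpos, sub_nonneg]

theorem figEight_add_figEight : figEight + figEight = 0 := by
  nth_rewrite 1 [← neg_figEight]
  exact neg_add_cancel _

theorem figEight_ne_zero : figEight ≠ 0 := fun h =>
  incomparable_figEight_zero.1 h.le

theorem addOrderOf_figEight : addOrderOf figEight = 2 :=
  addOrderOf_eq_prime (by rw [two_nsmul, figEight_add_figEight]) figEight_ne_zero

/-- Cancelling `x` would make the figure-eight class nonnegative. This is what gives antisymmetry in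
the quotient. -/
theorem not_le_add_figEight (x : LocalClass) : ¬ x ≤ x + figEight := fun h =>
  incomparable_figEight_zero.2 (by simpa using h)

theorem coe_eq_coe_iff {x y : LocalClass} :
    (x : ModFigEight) = y ↔ x = y ∨ x = y + figEight := by
  rw [eq_comm, QuotientAddGroup.eq, AddSubgroup.mem_zmultiples_iff]
  constructor
  · rintro ⟨k, hk⟩
    have hx : x = y + k • figEight := by rw [hk, add_neg_cancel_left]
    obtain ⟨m, rfl | rfl⟩ := Int.even_or_odd' k
    · left
      rw [hx, mul_comm, mul_smul, two_smul, figEight_add_figEight, smul_zero, add_zero]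
    · right
      rw [hx, add_smul, mul_comm, mul_smul, two_smul, figEight_add_figEight, smul_zero, zero_add,
        one_smul]
  · rintro (rfl | rfl)
    · exact ⟨0, by simp⟩
    · exact ⟨1, by simp⟩

/-! ### The total order on the quotient -/

namespace ModFigEight

/-- Cosets have two elements, and adding the figure-eight class to both sides moves its appearance
on the left over to the right. The left representative may therefore be fixed, which is what
transitivity needs. -/
theorem le_coe_iff {x y : LocalClass} : le (x : ModFigEight) y ↔ x ≤ y ∨ x ≤ y + figEight := by
  constructor
  · rintro ⟨a, b, ha, hb, hab⟩
    rcases coe_eq_coe_iff.1 ha with rfl | rfl <;> rcases coe_eq_coe_iff.1 hb with rfl | rfl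
    · exact Or.inl hab
    · exact Or.inr hab
    · right
      have := add_le_add_right' hab figEight
      rwa [add_assoc, figEight_add_figEight, add_zero] at this
    · exact Or.inl (by simpa using hab)
  · rintro (h | h)
    · exact ⟨x, y, rfl, rfl, h⟩
    · exact ⟨x, y + figEight, rfl, coe_eq_coe_iff.2 (Or.inr rfl), h⟩

theorem le_add_right {p q : ModFigEight} (h : le p q) (r : ModFigEight) :
    le (p + r) (q + r) := by
  obtain ⟨x, y, rfl, rfl, h⟩ := h
  obtain ⟨z, rfl⟩ := QuotientAddGroup.mk_surjective r
  exact ⟨x + z, y + z, rfl, rfl, add_le_add_right' h z⟩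

theorem le_rfl' (p : ModFigEight) : le p p := by
  obtain ⟨x, rfl⟩ := QuotientAddGroup.mk_surjective p
  exact ⟨x, x, rfl, rfl, le_rfl⟩

theorem le_trans' {p q r : ModFigEight} (h : le p q) (h' : le q r) : le p r := by
  obtain ⟨x, y, rfl, rfl, h⟩ := h
  obtain ⟨z, rfl⟩ := QuotientAddGroup.mk_surjective r
  rw [le_coe_iff] at h' ⊢
  exact h'.imp h.trans h.trans

theorem le_antisymm' {p q : ModFigEight} (h : le p q) (h' : le q p) : p = q := by
  obtain ⟨x, y, rfl, rfl, h⟩ := h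
  rcases le_coe_iff.1 h' with h' | h'
  · rw [le_antisymm h h']
  · exact absurd (h.trans h') (not_le_add_figEight x)

theorem le_total' (p q : ModFigEight) : le p q ∨ le q p := by
  obtain ⟨x, rfl⟩ := QuotientAddGroup.mk_surjective p
  obtain ⟨y, rfl⟩ := QuotientAddGroup.mk_surjective q
  -- Incomparable representatives differ by the figure-eight class, so they define the same element
  -- of the quotient.
  by_cases h : Incomparable x y
  · left
    rw [coe_eq_coe_iff.2 (Or.inr (incomparable_iff.1 h))]
    exact le_rfl' _
  · rw [Incomparable, not_and_or, not_not, not_not] at h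
    exact h.imp (fun h => ⟨x, y, rfl, rfl, h⟩) fun h => ⟨y, x, rfl, rfl, h⟩

theorem isLinearOrder : IsLinearOrder ModFigEight le where
  refl := le_rfl'
  trans _ _ _ := le_trans'
  antisymm _ _ := le_antisymm'
  total := le_total'

end ModFigEight

end LocalClass

end

end HorizontalIota

theorem mainTheorem5 :
    (∀ x y : HorizontalIota.LocalClass,
      HorizontalIota.LocalClass.Incomparable x y ↔ x = y + HorizontalIota.LocalClass.figEight) ∧
    addOrderOf HorizontalIota.LocalClass.figEight = 2 ∧
    IsLinearOrder HorizontalIota.LocalClass.ModFigEight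
      HorizontalIota.LocalClass.ModFigEight.le ∧
    (∀ p q r : HorizontalIota.LocalClass.ModFigEight,
      HorizontalIota.LocalClass.ModFigEight.le p q →
        HorizontalIota.LocalClass.ModFigEight.le (p + r) (q + r)) := by
  exact ⟨fun _ _ => HorizontalIota.LocalClass.incomparable_iff,
    HorizontalIota.LocalClass.addOrderOf_figEight,
    HorizontalIota.LocalClass.ModFigEight.isLinearOrder,
    fun _ _ r h => HorizontalIota.LocalClass.ModFigEight.le_add_right h r⟩
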